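/- Let $n\ge 1$, let $q$ be a formal parameter, $\varepsilon=q-q^{-1}$, and let all algebras be over $\mathbb C(q)$ unless said otherwise. Let $k$ be $\mathbb C$, or more generally any field of characteristic $0$ with an embedding $k\to\mathbb C(q)$. **Algebras.** $\mathcal C_n$ is the Clifford superalgebra with odd generators $c_1,\dots,c_n$, $c_i^2=1$, $c_ic_j=-c_jc_i$ $(i\ne j)$ (scalars extended to $\mathbb C(q)$). The *affine Hecke–Clifford algebra* $\widehat{\mathcal Hc}_n$ is generated by $T_i$ $(1\le i\le n-1)$, $c_i$, $X_i^{\pm1}$ $(1\le i\le n)$, with $X_iX_i^{-1}=X_i^{-1}X_i=1$, the relations above for the $c_i$, and $$(T_i-q)(T_i+q^{-1})=0,\quad T_iT_{i+1}T_i=T_{i+1}T_iT_{i+1},\quad T_iT_j=T_jT_i\ (|i-j|>1),$$ $$T_ic_i=c_{i+1}T_i,\quad T_ic_j=c_jT_i\ (j\ne i,i+1),\quad (T_i+\varepsilon c_ic_{i+1})X_iT_i=X_{i+1},\quad T_iX_j=X_jT_i\ (j\ne i,i+1),$$ $$X_iX_j=X_jX_i,\quad X_ic_i=c_iX_i^{-1},\quad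 X_ic_j=c_jX_i\ (i\ne j);$$ $T_i,X_i$ are even and $c_i$ is odd. The *spin affine Hecke algebra* $\widehat{\mathcal H}^-_n$ is generated by $R_i$ $(1\le i\le n-1)$, $p_i,q_i$ $(1\le i\le n)$, with $$R_i^2=-\varepsilon^2-2,\quad R_iR_j=-R_jR_i\ (|i-j|>1),\quad R_iR_{i+1}R_i-R_{i+1}R_iR_{i+1}=\varepsilon^2(R_{i+1}-R_i),$$ $$p_ip_j=p_jp_i,\quad q_iq_j=-q_jq_i\ (i\ne j),\quad p_i^2+q_i^2=1,\quad p_iq_j=q_jp_i\ (\text{all } i,j),$$ $$R_ip_j=p_jR_i,\quad R_iq_j=-q_jR_i\ (j\ne i,i+1),$$ $$R_ip_i=p_{i+1}R_i+\varepsilon(q_i-q_{i+1}),\quad R_iq_i=-q_{i+1}R_i-\varepsilon(p_i+p_{i+1});$$ $p_i$ is even and $q_i,R_i$ are odd. Tensor products of superalgebras have the product $(c'\otimes b')(c\otimes b)=(-1)^{|b'||c|}c'c\otimes b'b$. **Cyclotomic quotients.** Let $\mathcal A_1=k[p_1,q_1]/\langle p_1^2+q_1^2-1\rangle$, $\mathbb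 Z_2$-graded with $p_1$ even and $q_1$ odd. For a nonzero $\mathbb Z_2$-homogeneous ideal $I_1\subseteq\mathcal A_1$ let $\langle I_1\rangle$ be the two-sided ideal of $\widehat{\mathcal H}^-_n$ generated by the image of $I_1$; the *cyclotomic spin Hecke algebra* is $\mathcal H_n^{I,-}=\widehat{\mathcal H}^-_n/\langle I_1\rangle$. For a polynomial $F=\sum_{i=0}^d a_iX^i\in k[X]$ with $a_d=1$ and $a_i=a_0a_{d-i}$ for $0\le i\le d$, the *cyclotomic Hecke–Clifford algebra* is $\mathcal Hc_n^F=\widehat{\mathcal Hc}_n/\langle F(X_1)\rangle$. Both quotients inherit superalgebra structures. **Theorem.** There is an isomorphism of superalgebras $\Phi:\widehat{\mathcal Hc}_n\to\mathcal C_n\otimes\widehat{\mathcal H}^-_n$ with $$\Phi(c_i)=c_i,\quad \Phi(T_i)=-\tfrac12R_i(c_i-c_{i+1})+\tfrac{\varepsilon}{2}(1-c_ic_{i+1}),\quad \Phi(X_i^{\pm1})=p_i\mp c_iq_i,$$ whose inverse $\Psi$ satisfies $$\Psi(c_i)=c_i,\quad \Psi(R_i)=(c_i-c_{i+1})T_i+\varepsilon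 c_{i+1},\quad \Psi(p_i)=\tfrac12(X_i+X_i^{-1}),\quad \Psi(q_i)=\tfrac12(X_i-X_i^{-1})c_i,$$ and there is a bijection $F\mapsto I_1=e(F)$ from the set of polynomials $F\in k[X]$ as above onto the set of nonzero $\mathbb Z_2$-homogeneous ideals of $\mathcal A_1$ such that: 1. $\langle F(X_1)\rangle\mapsto\langle e(F)\rangle$ is a well-defined bijection from the set of the defining ideals of cyclotomic Hecke–Clifford algebras onto the set of the defining ideals of cyclotomic spin Hecke algebras; thus the cyclotomic Hecke–Clifford algebras and the cyclotomic spin Hecke algebras, as quotients of $\widehat{\mathcal Hc}_n$ and $\widehat{\mathcal H}^-_n$, are in bijection; 2. for every $F$, $\Phi$ induces an isomorphism of superalgebras $\mathcal Hc_n^F\to\mathcal C_n\otimes\mathcal H_n^{I,-}$, where $I=\langle e(F)\rangle$; 3. for every nonzero $\mathbb Z_2$-homogeneous ideal $I_1$ of $\mathcal A_1$, with $I=\langle I_1\rangle$, $\Psi$ induces an isomorphism of superalgebras $\mathcal C_n\otimes\mathcal H_n^{I,-}\to\mathcal Hc_n^{F}$, where $F=e^{-1}(I_1)$. -/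

import Mathlib

open scoped TensorProduct

noncomputable section

namespace SpinHecke

/-! ## Superalgebra structures coming from a parity automorphism -/

section Super

variable {F A B : Type*} [Field F] [Ring A] [Algebra F A] [Ring B] [Algebra F B]

/-- The sign `(-1)^i`. -/
def sgn (F : Type*) [Field F] (i : ZMod 2) : F := if i = 0 then 1 else -1

@[simp] theorem sgn_zero : sgn F 0 = 1 := by simp [sgn]

@[simp] theorem sgn_one : sgn F 1 = -1 := by simp [sgn]

theorem zcases (i : ZMod 2) : i = 0 ∨ i = 1 := by
  revert i; decide

theorem sgn_mul_self (i : ZMod 2) : sgn F i * sgn F i = 1 := by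
  rcases zcases i with rfl | rfl <;> simp

theorem sgn_add (i j : ZMod 2) : sgn F (i + j) = sgn F i * sgn F j := by
  have h : (1 + 1 : ZMod 2) = 0 := rfl
  rcases zcases i with rfl | rfl <;> rcases zcases j with rfl | rfl <;> simp [h]

/-- The homogeneous subspaces of the superalgebra structure with parity automorphism `σ`:
degree `0` is where `σ = 1` and degree `1` is where `σ = -1`. -/
def superGr (σ : A →ₐ[F] A) (i : ZMod 2) : Submodule F A where
  carrier := {a | σ a = sgn F i • a}
  add_mem' := by
    intro a b (ha : σ a = _) (hb : σ b = _)
    change σ (a + b) = _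
    rw [map_add, ha, hb, smul_add]
  zero_mem' := by simp
  smul_mem' := by
    intro c a (ha : σ a = _)
    change σ (c • a) = _
    rw [map_smul, ha, smul_comm]

theorem mem_superGr {σ : A →ₐ[F] A} {i : ZMod 2} {a : A} :
    a ∈ superGr σ i ↔ σ a = sgn F i • a := Iff.rfl

theorem half_mem_superGr {σ : A →ₐ[F] A} (hσ : ∀ a, σ (σ a) = a) (i : ZMod 2)
    (a : A) : (2⁻¹ : F) • (a + sgn F i • σ a) ∈ superGr σ i := by
  rw [mem_superGr, map_smul, map_add, map_smul, hσ, smul_comm (sgn F i), smul_add (sgn F i),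
    smul_smul, sgn_mul_self, one_smul, add_comm]

/-- The projection `a ↦ (a + (-1)^i σ a) / 2` to the component of degree `i`. -/
def superProj {σ : A →ₐ[F] A} (hσ : ∀ a, σ (σ a) = a) (i : ZMod 2) : A →ₗ[F] superGr σ i where
  toFun a := ⟨(2⁻¹ : F) • (a + sgn F i • σ a), half_mem_superGr hσ i a⟩
  map_add' a b := by
    apply Subtype.ext
    simp only [map_add, smul_add, Submodule.coe_add]
    abel
  map_smul' c a := by
    apply Subtype.ext
    simp only [map_smul, RingHom.id_apply, Submodule.coe_smul]
    rw [smul_comm (sgn F i) c, ← smul_add, smul_comm]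

theorem coe_superProj {σ : A →ₐ[F] A} (hσ : ∀ a, σ (σ a) = a) (i : ZMod 2) (a : A) :
    (superProj hσ i a : A) = (2⁻¹ : F) • (a + sgn F i • σ a) := rfl

/-- An involutive algebra automorphism is the parity automorphism of a superalgebra structure. -/
@[reducible] def superGraded [CharZero F] (σ : A →ₐ[F] A) (hσ : ∀ a, σ (σ a) = a) :
    GradedAlgebra (superGr σ) where
  one_mem := by simp [mem_superGr]
  mul_mem := by
    intro i j a b ha hb
    rw [mem_superGr] at *
    rw [map_mul, ha, hb, smul_mul_smul_comm, sgn_add]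
  toDecomposition := DirectSum.Decomposition.ofLinearMap _
    (∑ i : ZMod 2, (DirectSum.lof F (ZMod 2) (fun i => superGr σ i) i) ∘ₗ superProj hσ i)
    (by
      ext a
      have hu : (Finset.univ : Finset (ZMod 2)) = {0, 1} := rfl
      simp only [LinearMap.comp_apply, hu, LinearMap.sum_apply, map_sum,
        DirectSum.coeLinearMap_lof]
      rw [Finset.sum_pair (by decide)]
      simp only [coe_superProj, LinearMap.id_apply, sgn_zero, sgn_one, one_smul, neg_smul]
      rw [← smul_add, show a + σ a + (a + -σ a) = (2 : F) • a by rw [two_smul]; abel, smul_smul]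
      simp)
    (by
      refine DirectSum.linearMap_ext F fun i => ?_
      ext1 ⟨a, ha⟩
      have hu : (Finset.univ : Finset (ZMod 2)) = {0, 1} := rfl
      simp only [LinearMap.comp_apply, LinearMap.id_apply, DirectSum.coeLinearMap_lof,
        LinearMap.sum_apply, hu]
      rw [Finset.sum_pair (by decide)]
      have ha' := mem_superGr.1 ha
      have key1 : superProj hσ i a = ⟨a, ha⟩ := by
        apply Subtype.ext
        rw [coe_superProj, ha', smul_smul, sgn_mul_self, one_smul, ← two_smul F a, smul_smul]
        simp
      have key0 : ∀ j : ZMod 2, i ≠ j → superProj hσ j a = 0 := by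
        intro j hj
        apply Subtype.ext
        have hs : sgn F j * sgn F i = -1 := by
          rcases zcases i with rfl | rfl <;> rcases zcases j with rfl | rfl <;> simp at hj ⊢
        rw [coe_superProj, ha', smul_smul, hs]
        simp
      rcases zcases i with rfl | rfl
      · rw [key1, key0 1 (by decide), map_zero, add_zero]
      · rw [key1, key0 0 (by decide), map_zero, zero_add])

/-- The grading that the quotient of a superalgebra by a two-sided ideal inherits. -/
def quotGr (I : TwoSidedIdeal A) (𝒜 : ZMod 2 → Submodule F A) (i : ZMod 2) :
    Submodule F I.ringCon.Quotient :=
  (𝒜 i).map (I.ringCon.mkₐ (α := F)).toLinearMap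

/-- The total grading on the underlying space of the tensor product of two superalgebras:
degree `i` is spanned by `a ⊗ b` with `deg a + deg b = i`. -/
def tensorGr (𝒜 : ZMod 2 → Submodule F A) (ℬ : ZMod 2 → Submodule F B)
    [GradedAlgebra 𝒜] [GradedAlgebra ℬ] (i : ZMod 2) : Submodule F (𝒜 ᵍ⊗[F] ℬ) :=
  Submodule.span F {x | ∃ j l : ZMod 2, j + l = i ∧ ∃ a ∈ 𝒜 j, ∃ b ∈ ℬ l, x = a ᵍ⊗ₜ[F] b}

/-- `φ` preserves the `ℤ/2`-gradings, i.e. is an isomorphism of superalgebras. -/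
def IsSuper (𝒜 : ZMod 2 → Submodule F A) (ℬ : ZMod 2 → Submodule F B) (φ : A ≃ₐ[F] B) : Prop :=
  ∀ i, (𝒜 i).map φ.toLinearMap = ℬ i

theorem superGr_map_of_surjective [CharZero F] {σ : A →ₐ[F] A} (hσ : ∀ a, σ (σ a) = a)
    {τ : B →ₐ[F] B} {π : A →ₐ[F] B} (hπ : Function.Surjective π)
    (h : ∀ a, τ (π a) = π (σ a)) (i : ZMod 2) :
    (superGr σ i).map π.toLinearMap = superGr τ i := by
  ext b
  constructor
  · rintro ⟨a, ha, rfl⟩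
    have ha' := mem_superGr.1 ha
    rw [mem_superGr]
    simp [h, ha']
  · intro hb
    obtain ⟨a, rfl⟩ := hπ b
    refine ⟨_, half_mem_superGr hσ i a, ?_⟩
    rw [mem_superGr, h] at hb
    simp only [AlgHom.toLinearMap_apply, map_smul, map_add, hb]
    rw [smul_smul, sgn_mul_self, one_smul, ← two_smul F (π a), smul_smul]
    simp

/-- The quotient of a superalgebra by a two-sided ideal stable under the parity automorphism is
a superalgebra. -/
@[reducible] def quotGraded [CharZero F] (σ : A →ₐ[F] A) (hσ : ∀ a, σ (σ a) = a) (I : TwoSidedIdeal A)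
    (hI : I ≤ I.comap σ) : GradedAlgebra (quotGr (F := F) I (superGr σ)) := by
  let τ : I.ringCon.Quotient →ₐ[F] I.ringCon.Quotient :=
    I.ringCon.liftₐ ((I.ringCon.mkₐ (α := F)).comp σ) (by
      intro x y hxy
      rw [RingCon.ker_apply]
      have h1 : x - y ∈ I := (TwoSidedIdeal.rel_iff I x y).1 hxy
      have h2 : σ (x - y) ∈ I := TwoSidedIdeal.mem_comap σ |>.1 (hI h1)
      rw [map_sub] at h2
      exact (RingCon.eq I.ringCon).2 ((TwoSidedIdeal.rel_iff I _ _).2 h2))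
  have hτ : ∀ a, τ (I.ringCon.mkₐ (α := F) a) = I.ringCon.mkₐ (α := F) (σ a) := fun a => rfl
  have hs : Function.Surjective (I.ringCon.mkₐ (α := F)) := RingCon.mkₐ_surjective I.ringCon
  have e : quotGr (F := F) I (superGr σ) = superGr τ :=
    funext fun i => superGr_map_of_surjective hσ hs hτ i
  rw [e]
  refine superGraded τ fun b => ?_
  obtain ⟨a, rfl⟩ := hs b
  rw [hτ, hτ, hσ]

end Super

/-! ## The ground field and the Clifford algebra -/

/-- The ground field `ℂ(q)`. -/
abbrev Kq : Type := RatFunc ℂ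

/-- The formal parameter `q`. -/
def qq : Kq := RatFunc.X

/-- `ε = q - q⁻¹`. -/
def eps : Kq := qq - qq⁻¹

instance : CharZero Kq := charZero_of_injective_algebraMap (algebraMap ℂ Kq).injective

/-- The form `x₁² + ⋯ + xₙ²` in `n = m + 1` variables. -/
abbrev cliffForm (m : ℕ) : QuadraticForm Kq (Fin (m + 1) → Kq) :=
  QuadraticMap.weightedSumSquares Kq (fun _ => (1 : Kq))

/-- The Clifford algebra `𝒞ₙ`, `n = m + 1`, with scalars extended to `ℂ(q)`. -/
abbrev Cliff (m : ℕ) : Type := CliffordAlgebra (cliffForm m)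

/-- The `ℤ/2`-grading of `𝒞ₙ`, in which the `cᵢ` are odd. -/
abbrev cliffGr (m : ℕ) : ZMod 2 → Submodule Kq (Cliff m) := CliffordAlgebra.evenOdd (cliffForm m)

/-- The generators `cᵢ` of `𝒞ₙ`; `cᵢ² = 1` and `cᵢcⱼ = -cⱼcᵢ` for `i ≠ j`. -/
def cliffC {m : ℕ} (i : Fin (m + 1)) : Cliff m := CliffordAlgebra.ι (cliffForm m) (Pi.single i 1)

/-! ## The affine Hecke-Clifford algebra, of rank `n = m + 1`

The indices `1, …, n` are represented by `Fin (m + 1)` and `1, …, n - 1` by `Fin m`; for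
`i : Fin m`, the indices `i` and `i + 1` in `1, …, n` are `i.castSucc` and `i.succ`. -/

/-- Generators of the affine Hecke-Clifford algebra; `Xi i` stands for `Xᵢ⁻¹`. -/
inductive HCGen (m : ℕ) : Type
  | T (i : Fin m)
  | c (i : Fin (m + 1))
  | X (i : Fin (m + 1))
  | Xi (i : Fin (m + 1))

namespace HCGen
variable {m : ℕ}
/-- free generators -/
abbrev fT (i : Fin m) : FreeAlgebra Kq (HCGen m) := FreeAlgebra.ι Kq (T i)
/-- free generators -/
abbrev fc (i : Fin (m + 1)) : FreeAlgebra Kq (HCGen m) := FreeAlgebra.ι Kq (c i)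
/-- free generators -/
abbrev fX (i : Fin (m + 1)) : FreeAlgebra Kq (HCGen m) := FreeAlgebra.ι Kq (X i)
/-- free generators -/
abbrev fXi (i : Fin (m + 1)) : FreeAlgebra Kq (HCGen m) := FreeAlgebra.ι Kq (Xi i)
end HCGen

open HCGen in
/-- Defining relations of the affine Hecke-Clifford algebra. -/
inductive HCRel (m : ℕ) : FreeAlgebra Kq (HCGen m) → FreeAlgebra Kq (HCGen m) → Prop
  | hecke (i : Fin m) :
      HCRel m ((fT i - algebraMap Kq _ qq) * (fT i + algebraMap Kq _ qq⁻¹)) 0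
  | braid (i j : Fin m) (h : (j : ℕ) = i + 1) : HCRel m (fT i * fT j * fT i) (fT j * fT i * fT j)
  | far (i j : Fin m) (h : (i : ℕ) + 1 < j ∨ (j : ℕ) + 1 < i) : HCRel m (fT i * fT j) (fT j * fT i)
  | T_c (i : Fin m) : HCRel m (fT i * fc i.castSucc) (fc i.succ * fT i)
  | T_c_far (i : Fin m) (j : Fin (m + 1)) (h : j ≠ i.castSucc) (h' : j ≠ i.succ) :
      HCRel m (fT i * fc j) (fc j * fT i)
  | c_sq (i : Fin (m + 1)) : HCRel m (fc i * fc i) 1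
  | c_c (i j : Fin (m + 1)) (h : i ≠ j) : HCRel m (fc i * fc j) (-(fc j * fc i))
  | X_Xi (i : Fin (m + 1)) : HCRel m (fX i * fXi i) 1
  | Xi_X (i : Fin (m + 1)) : HCRel m (fXi i * fX i) 1
  | T_X_T (i : Fin m) :
      HCRel m ((fT i + eps • (fc i.castSucc * fc i.succ)) * fX i.castSucc * fT i) (fX i.succ)
  | T_X_far (i : Fin m) (j : Fin (m + 1)) (h : j ≠ i.castSucc) (h' : j ≠ i.succ) :
      HCRel m (fT i * fX j) (fX j * fT i)
  | X_X (i j : Fin (m + 1)) : HCRel m (fX i * fX j) (fX j * fX i)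
  | X_c (i : Fin (m + 1)) : HCRel m (fX i * fc i) (fc i * fXi i)
  | X_c_far (i j : Fin (m + 1)) (h : i ≠ j) : HCRel m (fX i * fc j) (fc j * fX i)

/-- The affine Hecke-Clifford algebra of rank `n = m + 1` over `ℂ(q)`. -/
def AffHC (m : ℕ) : Type := RingQuot (HCRel m)

instance (m : ℕ) : Ring (AffHC m) := inferInstanceAs (Ring (RingQuot (HCRel m)))
instance (m : ℕ) : Algebra Kq (AffHC m) := inferInstanceAs (Algebra Kq (RingQuot (HCRel m)))

namespace AffHC
variable {m : ℕ}

/-- The presentation map. -/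
def mk (m : ℕ) : FreeAlgebra Kq (HCGen m) →ₐ[Kq] AffHC m := RingQuot.mkAlgHom Kq (HCRel m)

/-- The generator `Tᵢ`. -/
def T (i : Fin m) : AffHC m := mk m (HCGen.fT i)
/-- The generator `cᵢ`. -/
def c (i : Fin (m + 1)) : AffHC m := mk m (HCGen.fc i)
/-- The generator `Xᵢ`. -/
def X (i : Fin (m + 1)) : AffHC m := mk m (HCGen.fX i)
/-- The generator `Xᵢ⁻¹`. -/
def Xi (i : Fin (m + 1)) : AffHC m := mk m (HCGen.fXi i)

theorem mk_rel {a b : FreeAlgebra Kq (HCGen m)} (h : HCRel m a b) : mk m a = mk m b :=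
  RingQuot.mkAlgHom_rel Kq h

/-- The parity automorphism on free generators: `cᵢ` is odd, `Tᵢ, Xᵢ, Xᵢ⁻¹` are even. -/
def parityGen : HCGen m → AffHC m
  | .T i => T i
  | .c i => -c i
  | .X i => X i
  | .Xi i => Xi i

theorem parity_rel ⦃a b : FreeAlgebra Kq (HCGen m)⦄ (h : HCRel m a b) :
    FreeAlgebra.lift Kq (parityGen (m := m)) a = FreeAlgebra.lift Kq (parityGen (m := m)) b := by
  have h' := mk_rel h
  induction h <;>
    simpa [parityGen, T, c, X, Xi, FreeAlgebra.lift_ι_apply] using h'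

/-- The parity automorphism of the affine Hecke-Clifford algebra. -/
def parity (m : ℕ) : AffHC m →ₐ[Kq] AffHC m :=
  RingQuot.liftAlgHom Kq ⟨FreeAlgebra.lift Kq (parityGen (m := m)), parity_rel⟩

/-- The canonical superalgebra structure: `Tᵢ, Xᵢ` even, `cᵢ` odd. -/
abbrev gr (m : ℕ) : ZMod 2 → Submodule Kq (AffHC m) := superGr (parity m)

end AffHC

/-! ## The spin affine Hecke algebra, of rank `n = m + 1` -/

/-- Generators of the spin affine Hecke algebra. -/
inductive SpinGen (m : ℕ) : Type
  | R (i : Fin m)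
  | p (i : Fin (m + 1))
  | q (i : Fin (m + 1))

namespace SpinGen
variable {m : ℕ}
/-- free generators -/
abbrev fR (i : Fin m) : FreeAlgebra Kq (SpinGen m) := FreeAlgebra.ι Kq (R i)
/-- free generators -/
abbrev fp (i : Fin (m + 1)) : FreeAlgebra Kq (SpinGen m) := FreeAlgebra.ι Kq (p i)
/-- free generators -/
abbrev fq (i : Fin (m + 1)) : FreeAlgebra Kq (SpinGen m) := FreeAlgebra.ι Kq (q i)
end SpinGen

open SpinGen in
/-- Defining relations of the spin affine Hecke algebra. -/
inductive SpinRel (m : ℕ) : FreeAlgebra Kq (SpinGen m) → FreeAlgebra Kq (SpinGen m) → Prop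
  | R_sq (i : Fin m) : SpinRel m (fR i * fR i) (algebraMap Kq _ (-eps ^ 2 - 2))
  | R_far (i j : Fin m) (h : (i : ℕ) + 1 < j ∨ (j : ℕ) + 1 < i) :
      SpinRel m (fR i * fR j) (-(fR j * fR i))
  | braid (i j : Fin m) (h : (j : ℕ) = i + 1) :
      SpinRel m (fR i * fR j * fR i - fR j * fR i * fR j) (eps ^ 2 • (fR j - fR i))
  | p_p (i j : Fin (m + 1)) : SpinRel m (fp i * fp j) (fp j * fp i)
  | q_q (i j : Fin (m + 1)) (h : i ≠ j) : SpinRel m (fq i * fq j) (-(fq j * fq i))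
  | circle (i : Fin (m + 1)) : SpinRel m (fp i * fp i + fq i * fq i) 1
  | p_q (i j : Fin (m + 1)) : SpinRel m (fp i * fq j) (fq j * fp i)
  | R_p_far (i : Fin m) (j : Fin (m + 1)) (h : j ≠ i.castSucc) (h' : j ≠ i.succ) :
      SpinRel m (fR i * fp j) (fp j * fR i)
  | R_q_far (i : Fin m) (j : Fin (m + 1)) (h : j ≠ i.castSucc) (h' : j ≠ i.succ) :
      SpinRel m (fR i * fq j) (-(fq j * fR i))
  | R_p (i : Fin m) :
      SpinRel m (fR i * fp i.castSucc)
        (fp i.succ * fR i + eps • (fq i.castSucc - fq i.succ))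
  | R_q (i : Fin m) :
      SpinRel m (fR i * fq i.castSucc)
        (-(fq i.succ * fR i) - eps • (fp i.castSucc + fp i.succ))

/-- The spin affine Hecke algebra of rank `n = m + 1` over `ℂ(q)`. -/
def AffSpin (m : ℕ) : Type := RingQuot (SpinRel m)

instance (m : ℕ) : Ring (AffSpin m) := inferInstanceAs (Ring (RingQuot (SpinRel m)))
instance (m : ℕ) : Algebra Kq (AffSpin m) := inferInstanceAs (Algebra Kq (RingQuot (SpinRel m)))

namespace AffSpin
variable {m : ℕ}

/-- The presentation map. -/
def mk (m : ℕ) : FreeAlgebra Kq (SpinGen m) →ₐ[Kq] AffSpin m := RingQuot.mkAlgHom Kq (SpinRel m)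

/-- The generator `Rᵢ`. -/
def R (i : Fin m) : AffSpin m := mk m (SpinGen.fR i)
/-- The generator `pᵢ`. -/
def p (i : Fin (m + 1)) : AffSpin m := mk m (SpinGen.fp i)
/-- The generator `qᵢ`. -/
def q (i : Fin (m + 1)) : AffSpin m := mk m (SpinGen.fq i)

theorem mk_rel {a b : FreeAlgebra Kq (SpinGen m)} (h : SpinRel m a b) : mk m a = mk m b :=
  RingQuot.mkAlgHom_rel Kq h

theorem commute_p_q (i j : Fin (m + 1)) : Commute (p i) (q j) := by
  simpa [p, q, Commute, SemiconjBy] using mk_rel (SpinRel.p_q i j)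

theorem circle (i : Fin (m + 1)) : p i * p i + q i * q i = 1 := by
  simpa [p, q] using mk_rel (SpinRel.circle i)

/-- The parity automorphism on free generators: `pᵢ` is even, `qᵢ, Rᵢ` are odd. -/
def parityGen : SpinGen m → AffSpin m
  | .R i => -R i
  | .p i => p i
  | .q i => -q i

theorem parity_rel ⦃a b : FreeAlgebra Kq (SpinGen m)⦄ (h : SpinRel m a b) :
    FreeAlgebra.lift Kq (parityGen (m := m)) a = FreeAlgebra.lift Kq (parityGen (m := m)) b := by
  have h' := mk_rel h
  induction h with
  | braid i j h =>
    simp only [map_sub, map_mul, map_smul] at h'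
    simp only [map_sub, map_mul, map_smul, FreeAlgebra.lift_ι_apply, parityGen, R]
    rw [← neg_inj]
    convert h' using 1
    · noncomm_ring
    · rw [← smul_neg]; congr 1; abel
  | R_p i =>
    simp only [map_add, map_sub, map_mul, map_smul] at h'
    simp only [map_add, map_sub, map_mul, map_smul, FreeAlgebra.lift_ι_apply, parityGen, R, p, q]
    rw [← neg_inj]
    convert h' using 1
    · noncomm_ring
    · rw [neg_add, ← smul_neg]; congr 1
      · noncomm_ring
      · congr 1; abel
  | _ =>
    simpa [parityGen, R, p, q, FreeAlgebra.lift_ι_apply] using h'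

/-- The parity automorphism of the spin affine Hecke algebra. -/
def parity (m : ℕ) : AffSpin m →ₐ[Kq] AffSpin m :=
  RingQuot.liftAlgHom Kq ⟨FreeAlgebra.lift Kq (parityGen (m := m)), parity_rel⟩

theorem parity_mk (x : FreeAlgebra Kq (SpinGen m)) :
    parity m (mk m x) = FreeAlgebra.lift Kq (parityGen (m := m)) x :=
  RingQuot.liftAlgHom_mkAlgHom_apply Kq _ _ x

theorem parity_R (i : Fin m) : parity m (R i) = -R i := by
  rw [R, parity_mk, FreeAlgebra.lift_ι_apply]; rfl

theorem parity_p (i : Fin (m + 1)) : parity m (p i) = p i := by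
  rw [p, parity_mk, FreeAlgebra.lift_ι_apply]; rfl

theorem parity_q (i : Fin (m + 1)) : parity m (q i) = -q i := by
  rw [q, parity_mk, FreeAlgebra.lift_ι_apply]; rfl

theorem parity_parity (a : AffSpin m) : parity m (parity m a) = a := by
  have h : (parity m).comp (parity m) = AlgHom.id Kq (AffSpin m) := by
    refine RingQuot.ringQuot_ext' Kq _ _ (FreeAlgebra.hom_ext (funext fun g => ?_))
    cases g with
    | R i =>
      change parity m (parity m (R i)) = R i
      rw [parity_R, map_neg, parity_R, neg_neg]
    | p i =>
      change parity m (parity m (p i)) = p i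
      rw [parity_p, parity_p]
    | q i =>
      change parity m (parity m (q i)) = q i
      rw [parity_q, map_neg, parity_q, neg_neg]
  exact DFunLike.congr_fun h a

/-- The canonical superalgebra structure: `pᵢ` even, `qᵢ, Rᵢ` odd. -/
abbrev gr (m : ℕ) : ZMod 2 → Submodule Kq (AffSpin m) := superGr (parity m)

instance (m : ℕ) : GradedAlgebra (gr m) := superGraded (parity m) parity_parity

end AffSpin

/-! ## Cyclotomic Hecke-Clifford algebras and cyclotomic spin Hecke algebras -/

section Cyclotomic

open Polynomial

variable (k : Type*) [Field k]

/-- The ideal `(p₁² + q₁² - 1)` of `k[p₁, q₁]`; the inner variable is `p₁`, the outer one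
is `q₁`. -/
def circleIdeal : Ideal k[X][X] := Ideal.span {C X ^ 2 + X ^ 2 - 1}

/-- `𝒜₁ = k[p₁, q₁] / (p₁² + q₁² - 1)`. -/
def A1 : Type _ := k[X][X] ⧸ circleIdeal k

instance : CommRing (A1 k) := inferInstanceAs (CommRing (k[X][X] ⧸ circleIdeal k))
instance : Algebra k (A1 k) := inferInstanceAs (Algebra k (k[X][X] ⧸ circleIdeal k))

/-- The quotient map `k[p₁, q₁] → 𝒜₁`. -/
def A1.mk : k[X][X] →ₐ[k] A1 k := Ideal.Quotient.mkₐ k (circleIdeal k)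

theorem A1.mk_surjective : Function.Surjective (A1.mk k) := Ideal.Quotient.mkₐ_surjective _ _

/-- The automorphism `p₁ ↦ p₁`, `q₁ ↦ -q₁` of `k[p₁, q₁]`. -/
def flipQ : k[X][X] →ₐ[k] k[X][X] :=
  (Polynomial.aeval (-X : k[X][X]) : k[X][X] →ₐ[k[X]] k[X][X]).restrictScalars k

theorem flipQ_flipQ (f : k[X][X]) : flipQ k (flipQ k f) = f := by
  change aeval (-X : k[X][X]) (aeval (-X : k[X][X]) f) = f
  rw [← Polynomial.aeval_algHom_apply]
  simp

theorem mk_flipQ_eq_zero (f : k[X][X]) (hf : f ∈ circleIdeal k) : A1.mk k (flipQ k f) = 0 := by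
  have h : circleIdeal k ≤ RingHom.ker ((A1.mk k).comp (flipQ k)) := by
    rw [circleIdeal, Ideal.span_le, Set.singleton_subset_iff]
    refine (RingHom.mem_ker).2 (Ideal.Quotient.eq_zero_iff_mem.2 ?_)
    apply Ideal.subset_span
    have h2 : (-X : k[X][X]) ^ 2 = X ^ 2 := by ring
    simp [flipQ, Polynomial.aeval_C, h2]
  exact h hf

/-- The parity automorphism of `𝒜₁`, `p₁ ↦ p₁`, `q₁ ↦ -q₁`. -/
def A1.parity : A1 k →ₐ[k] A1 k :=
  Ideal.Quotient.liftₐ (circleIdeal k) ((A1.mk k).comp (flipQ k)) (mk_flipQ_eq_zero k)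

theorem A1.parity_mk (f : k[X][X]) : A1.parity k (A1.mk k f) = A1.mk k (flipQ k f) := rfl

theorem A1.parity_parity (a : A1 k) : A1.parity k (A1.parity k a) = a := by
  obtain ⟨f, rfl⟩ := A1.mk_surjective k a
  rw [A1.parity_mk, A1.parity_mk, flipQ_flipQ]

/-- The `ℤ/2`-grading of `𝒜₁`: `p₁` is even and `q₁` is odd. -/
abbrev A1.gr : ZMod 2 → Submodule k (A1 k) := superGr (A1.parity k)

instance [CharZero k] : GradedAlgebra (A1.gr k) := superGraded (A1.parity k) (A1.parity_parity k)

/-- The nonzero `ℤ/2`-homogeneous ideals of `𝒜₁`. -/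
def HomogIdeal [CharZero k] : Type _ := {I : Ideal (A1 k) // I ≠ ⊥ ∧ I.IsHomogeneous (A1.gr k)}

theorem HomogIdeal.parity_mem {k : Type*} [Field k] [CharZero k] (I : HomogIdeal k) {a : A1 k} (ha : a ∈ I.1) :
    A1.parity k a ∈ I.1 := by
  classical
  have e := DirectSum.sum_support_decompose (A1.gr k) a
  rw [← e, map_sum]
  refine Ideal.sum_mem _ fun i _ => ?_
  rw [mem_superGr.1 (SetLike.coe_mem _), Algebra.smul_def]
  exact I.1.mul_mem_left _ (I.2.2 i ha)

/-- The polynomials `F = a_d X^d + ⋯ + a₀` with `a_d = 1` and `a_i = a₀ a_{d-i}`, `0 ≤ i ≤ d`. -/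
def CycPoly : Type _ :=
  {F : k[X] // F.Monic ∧ ∀ i ≤ F.natDegree, F.coeff i = F.coeff 0 * F.coeff (F.natDegree - i)}

variable {k} [Algebra k Kq] (m : ℕ)

/-- Substitution of `p₁` into polynomials. -/
def evalP : k[X] →+* AffSpin m :=
  (aeval (AffSpin.p (0 : Fin (m + 1)))).toRingHom.comp (mapRingHom (algebraMap k Kq))

theorem evalP_commute (f : k[X]) : Commute (evalP m f) (AffSpin.q 0) := by
  change Commute (aeval (AffSpin.p (0 : Fin (m + 1))) (f.map (algebraMap k Kq))) _
  induction f.map (algebraMap k Kq) using Polynomial.induction_on' with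
  | add a b ha hb => rw [map_add]; exact ha.add_left hb
  | monomial n a =>
    rw [aeval_monomial]
    exact (Algebra.commute_algebraMap_left a _).mul_left ((AffSpin.commute_p_q 0 0).pow_left n)

/-- Substitution of `p₁, q₁` into polynomials in two (commuting) variables. -/
def evalPQ : k[X][X] →+* AffSpin m := eval₂RingHom' (evalP m) (AffSpin.q 0) (evalP_commute m)

theorem evalPQ_eq_zero (f : k[X][X]) (hf : f ∈ circleIdeal k) : evalPQ m f = 0 := by
  have h : circleIdeal k ≤ RingHom.ker (evalPQ (k := k) m) := by
    rw [circleIdeal, Ideal.span_le, Set.singleton_subset_iff]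
    refine (RingHom.mem_ker).2 ?_
    have h1 : evalPQ (k := k) m X = AffSpin.q 0 := eval₂_X _ _
    have h2 : evalPQ (k := k) m (C X) = AffSpin.p 0 := by
      refine (eval₂_C _ _).trans ?_
      simp [evalP]
    rw [map_sub, map_add, map_pow, map_pow, h1, h2, map_one, pow_two, pow_two, AffSpin.circle,
      sub_self]
  exact h hf

/-- The homomorphism from `𝒜₁` to the spin affine Hecke algebra, `p₁ ↦ p₁`, `q₁ ↦ q₁`. -/
def A1.toSpin : A1 k →+* AffSpin m :=
  Ideal.Quotient.lift (circleIdeal k) (evalPQ m) (evalPQ_eq_zero m)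

theorem A1.toSpin_mk (f : k[X][X]) : A1.toSpin m (A1.mk k f) = evalPQ m f := rfl

theorem parity_evalPQ (f : k[X][X]) : AffSpin.parity m (evalPQ m f) = evalPQ m (flipQ k f) := by
  have h : ((AffSpin.parity m : AffSpin m →+* AffSpin m).comp (evalPQ (k := k) m)) =
      (evalPQ m).comp (flipQ k : k[X][X] →+* k[X][X]) := by
    refine Polynomial.ringHom_ext' (Polynomial.ringHom_ext' ?_ ?_) ?_
    · ext c
      simp [evalPQ, eval₂RingHom', evalP, flipQ]
    · simp [evalPQ, eval₂RingHom', evalP, flipQ, AffSpin.parity_p]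
    · simp [evalPQ, eval₂RingHom', flipQ, AffSpin.parity_q]
  exact DFunLike.congr_fun h f

theorem A1.toSpin_parity (a : A1 k) :
    A1.toSpin m (A1.parity k a) = AffSpin.parity m (A1.toSpin m a) := by
  obtain ⟨f, rfl⟩ := A1.mk_surjective k a
  rw [A1.parity_mk, A1.toSpin_mk, A1.toSpin_mk, parity_evalPQ]

/-- The two-sided ideal `⟨F(X₁)⟩` of the affine Hecke-Clifford algebra. -/
def hcIdeal (F : CycPoly k) : TwoSidedIdeal (AffHC m) :=
  TwoSidedIdeal.span {aeval (AffHC.X (0 : Fin (m + 1))) (F.1.map (algebraMap k Kq))}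

/-- The cyclotomic Hecke-Clifford algebra attached to `F`. -/
abbrev CycHC (F : CycPoly k) : Type := (hcIdeal m F).ringCon.Quotient

/-- The quotient map onto the cyclotomic Hecke-Clifford algebra. -/
def CycHC.mk (F : CycPoly k) : AffHC m →ₐ[Kq] CycHC m F := (hcIdeal m F).ringCon.mkₐ (α := Kq)

/-- The superalgebra structure of the cyclotomic Hecke-Clifford algebra. -/
abbrev CycHC.gr (F : CycPoly k) : ZMod 2 → Submodule Kq (CycHC m F) :=
  quotGr (hcIdeal m F) (AffHC.gr m)

variable [CharZero k]

/-- The two-sided ideal `⟨I₁⟩` of the spin affine Hecke algebra generated by `I₁ ⊆ 𝒜₁`. -/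
def spinIdeal (I : HomogIdeal k) : TwoSidedIdeal (AffSpin m) :=
  TwoSidedIdeal.span (A1.toSpin m '' (I.1 : Set (A1 k)))

theorem spinIdeal_le_comap (I : HomogIdeal k) :
    spinIdeal m I ≤ (spinIdeal m I).comap (AffSpin.parity m) := by
  refine TwoSidedIdeal.span_le.2 ?_
  rintro _ ⟨a, ha, rfl⟩
  refine (TwoSidedIdeal.mem_comap _).2 ?_
  rw [← A1.toSpin_parity]
  exact TwoSidedIdeal.subset_span ⟨_, I.parity_mem ha, rfl⟩

/-- The cyclotomic spin Hecke algebra attached to `I₁`. -/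
abbrev CycSpin (I : HomogIdeal k) : Type := (spinIdeal m I).ringCon.Quotient

/-- The quotient map onto the cyclotomic spin Hecke algebra. -/
def CycSpin.mk (I : HomogIdeal k) : AffSpin m →ₐ[Kq] CycSpin m I :=
  (spinIdeal m I).ringCon.mkₐ (α := Kq)

/-- The superalgebra structure that the cyclotomic spin Hecke algebra inherits. -/
abbrev CycSpin.gr (I : HomogIdeal k) : ZMod 2 → Submodule Kq (CycSpin m I) :=
  quotGr (spinIdeal m I) (AffSpin.gr m)

instance (I : HomogIdeal k) : GradedAlgebra (CycSpin.gr m I) :=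
  quotGraded (AffSpin.parity m) AffSpin.parity_parity (spinIdeal m I) (spinIdeal_le_comap m I)

/-! ## The tensor products with the Clifford algebra and the maps `Φ`, `Ψ` -/

/-- `𝒞ₙ ⊗` (spin affine Hecke algebra), with the sign rule of superalgebras. -/
abbrev CliffSpin : Type := cliffGr m ᵍ⊗[Kq] AffSpin.gr m

/-- `𝒞ₙ ⊗` (cyclotomic spin Hecke algebra), with the sign rule of superalgebras. -/
abbrev CliffCycSpin (I : HomogIdeal k) : Type := cliffGr m ᵍ⊗[Kq] CycSpin.gr m I

/-- The map `𝒞ₙ ⊗` (spin affine) `→ 𝒞ₙ ⊗` (cyclotomic spin) induced by the quotient map. -/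
def CliffCycSpin.mk (I : HomogIdeal k) : CliffSpin m →ₗ[Kq] CliffCycSpin m I :=
  (GradedTensorProduct.of Kq (cliffGr m) (CycSpin.gr m I)).toLinearMap ∘ₗ
    TensorProduct.map LinearMap.id (CycSpin.mk m I).toLinearMap ∘ₗ
      (GradedTensorProduct.of Kq (cliffGr m) (AffSpin.gr m)).symm.toLinearMap

end Cyclotomic

section PhiPsi

variable {m : ℕ}

/-- `c ∈ 𝒞ₙ` as an element of `𝒞ₙ ⊗` (spin affine Hecke algebra). -/
def inC : Cliff m →ₐ[Kq] CliffSpin m := GradedTensorProduct.includeLeft (cliffGr m) (AffSpin.gr m)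

/-- An element of the spin affine Hecke algebra as an element of the tensor product. -/
def inS : AffSpin m →ₐ[Kq] CliffSpin m := GradedTensorProduct.includeRight (cliffGr m) (AffSpin.gr m)

/-- The values of `Φ` on the generators. -/
structure IsPhi (Φ : AffHC m → CliffSpin m) : Prop where
  c : ∀ i, Φ (AffHC.c i) = inC (cliffC i)
  T : ∀ i : Fin m, Φ (AffHC.T i) =
    -(2⁻¹ : Kq) • (inS (AffSpin.R i) * inC (cliffC i.castSucc - cliffC i.succ)) +
      (2⁻¹ * eps) • (1 - inC (cliffC i.castSucc * cliffC i.succ))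
  X : ∀ i, Φ (AffHC.X i) = inS (AffSpin.p i) - inC (cliffC i) * inS (AffSpin.q i)
  Xi : ∀ i, Φ (AffHC.Xi i) = inS (AffSpin.p i) + inC (cliffC i) * inS (AffSpin.q i)

/-- The values of `Ψ` on the generators. -/
structure IsPsi (Ψ : CliffSpin m → AffHC m) : Prop where
  c : ∀ i, Ψ (inC (cliffC i)) = AffHC.c i
  R : ∀ i : Fin m, Ψ (inS (AffSpin.R i)) =
    (AffHC.c i.castSucc - AffHC.c i.succ) * AffHC.T i + eps • AffHC.c i.succ
  p : ∀ i, Ψ (inS (AffSpin.p i)) = (2⁻¹ : Kq) • (AffHC.X i + AffHC.Xi i)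
  q : ∀ i, Ψ (inS (AffSpin.q i)) = (2⁻¹ : Kq) • ((AffHC.X i - AffHC.Xi i) * AffHC.c i)

end PhiPsi

end SpinHecke

end

open SpinHecke

set_option linter.unusedSimpArgs false
set_option linter.unusedSectionVars false

open scoped TensorProduct

noncomputable section

namespace SpinHecke

/-! ### Identities in an arbitrary algebra whose elements satisfy the relations of one side. -/

section Generic
variable {K A : Type*} [Field K] [CharZero K] [Ring A] [Algebra K A]

/-! In the super tensor product a Clifford generator anticommutes with every odd spin element, so an
odd spin element times an odd Clifford element is even. This exchanges the odd `Rᵢ`, `qᵢ` for the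
even `Tᵢ`, `Xᵢ` and back. Each defining relation of one algebra thereby becomes a finite computation
from the relations of the other. These computations are done once, for abstract elements of any
algebra: the relations, also in the form `a * (b * x) = z * x` for use inside longer words, rewrite
both sides to ordered words, and `module` compares coefficients.

`Φ` comes from the presentation of the Hecke-Clifford algebra. `Ψ` is glued from a map on the
Clifford algebra and one on the spin algebra by the universal property of the graded tensor product;
this requires the two images to supercommute (`c_mul_psiS`, `psi_anticomm`). Both composites are the
identity because they are so on generators.

For the cyclotomic quotients put `P = (X + X⁻¹)/2` and `D = (X - X⁻¹)/2` in the Laurent ring. Every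
element of `𝒜₁` is uniquely `f(p₁) + g(p₁) q₁`, and every Laurent polynomial is uniquely `f(P) +
g(P) D`. The resulting bijection `θ` (`A1.theta`) is not multiplicative, since `q₁² = 1 - p₁²` while
`D² = P² - 1`. However, it turns parity into `X ↦ X⁻¹`, multiplication by `f(p₁)` into
multiplication by `f(P)`, and multiplication by `q₁` into `x ↦ D · x(X⁻¹)`. Hence `θ` matches
homogeneous ideals of `𝒜₁` with inversion-stable Laurent ideals. A nonzero Laurent ideal has a
unique monic polynomial generator `F` with `F(0) ≠ 0`, and stability under inversion says exactly
that `F` satisfies `aᵢ = a₀ a_{d-i}`. So `e(F) = {a | F ∣ θ(a)}`.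

Under `Ψ`, `f(p₁) + g(p₁) q₁` goes to `f(P) + g(P) D c₁` evaluated at `X₁`. The even and odd parts
of an element of `e(F)` lie in `e(F)` separately and `c₁² = 1`, so `Ψ(e(F))` generates the same
two-sided ideal as `F(X₁)` (`psiS_toSpin_mem_hcIdeal`, `hcIdeal_le`), and `Φ`, `Ψ` descend to
inverse isomorphisms. Finally `⟨F(X₁)⟩` is the kernel of `Φ` followed by the quotient map of tensor
products, and `⟨e(F)⟩` is its preimage in the spin algebra, so each determines the other
(`hcIdeal_eq_iff`). -/

theorem reassoc {a b z : A} (h : a * b = z) (x : A) : a * (b * x) = z * x := by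
  rw [← mul_assoc, h]

/-- The expression of the Hecke generator through the spin generator and Clifford generators. -/
def heckeOfSpin (e : K) (c d R : A) : A :=
  -(2⁻¹ : K) • (R * (c - d)) + (2⁻¹ * e) • (1 - c * d)

theorem heckeOfSpin_sq {e : K} {c d R : A} (cc : c * c = 1) (dd : d * d = 1)
    (dc : d * c = -(c * d)) (cR : c * R = -(R * c)) (dR : d * R = -(R * d))
    (RR : R * R = (-e ^ 2 - 2) • (1 : A)) :
    heckeOfSpin e c d R * heckeOfSpin e c d R = e • heckeOfSpin e c d R + 1 := by
  unfold heckeOfSpin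
  simp only [mul_add, add_mul, mul_sub, sub_mul, smul_mul_assoc, mul_smul_comm, mul_assoc,
    cc, dd, dc, cR, dR, RR, reassoc cc, reassoc dd, reassoc dc, reassoc cR, reassoc dR, reassoc RR,
    one_mul, mul_one, neg_mul, mul_neg, neg_neg, smul_neg]
  module

/-- The two Hecke elements share the middle Clifford generator `d`. Words are normalised with the
spin generators on the left and `SRS` replaced through the deformed braid relation. Its lower-order
term `e ^ 2 • (S - R)` is what cancels the terms left over from the Clifford parts. -/
theorem heckeOfSpin_braid {e : K} {c d f R S : A} (cc : c * c = 1) (dd : d * d = 1)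
    (ff : f * f = 1)
    (dc : d * c = -(c * d)) (fc : f * c = -(c * f)) (fd : f * d = -(d * f))
    (cR : c * R = -(R * c)) (dR : d * R = -(R * d)) (fR : f * R = -(R * f))
    (cS : c * S = -(S * c)) (dS : d * S = -(S * d)) (fS : f * S = -(S * f))
    (RR : R * R = (-e ^ 2 - 2) • (1 : A)) (SS : S * S = (-e ^ 2 - 2) • (1 : A))
    (SRS : S * (R * S) = R * (S * R) - e ^ 2 • (S - R)) :
    heckeOfSpin e c d R * heckeOfSpin e d f S * heckeOfSpin e c d R =
      heckeOfSpin e d f S * heckeOfSpin e c d R * heckeOfSpin e d f S := by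
  have SRS' : ∀ x, S * (R * (S * x)) = R * (S * (R * x)) - e ^ 2 • (S * x - R * x) := by
    intro x
    have := congrArg (· * x) SRS
    simpa only [mul_assoc, sub_mul, smul_mul_assoc] using this
  unfold heckeOfSpin
  simp only [mul_add, add_mul, mul_sub, sub_mul, smul_mul_assoc, mul_smul_comm, mul_assoc,
    cc, dd, dc, cR, dR, RR, reassoc cc, reassoc dd, reassoc dc, reassoc cR, reassoc dR, reassoc RR,
    ff, fc, fd, fR, cS, dS, fS, SS, reassoc ff, reassoc fc, reassoc fd, reassoc fR, reassoc cS,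
    reassoc dS, reassoc fS, reassoc SS, SRS, SRS',
    one_mul, mul_one, neg_mul, mul_neg, neg_neg, smul_neg]
  module

theorem heckeOfSpin_far {e : K} {c d f g R S : A}
    (fc : f * c = -(c * f)) (fd : f * d = -(d * f))
    (gc : g * c = -(c * g)) (gd : g * d = -(d * g))
    (cS : c * S = -(S * c)) (dS : d * S = -(S * d))
    (fR : f * R = -(R * f)) (gR : g * R = -(R * g)) (SR : S * R = -(R * S)) :
    heckeOfSpin e c d R * heckeOfSpin e f g S = heckeOfSpin e f g S * heckeOfSpin e c d R := by
  unfold heckeOfSpin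
  simp only [mul_add, add_mul, mul_sub, sub_mul, smul_mul_assoc, mul_smul_comm, mul_assoc,
    fc, fd, gc, gd, cS, dS, fR, gR, SR, reassoc fc, reassoc fd, reassoc gc, reassoc gd,
    reassoc cS, reassoc dS, reassoc fR, reassoc gR, reassoc SR,
    one_mul, mul_one, neg_mul, mul_neg, neg_neg, smul_neg]
  module

theorem heckeOfSpin_mul_left {e : K} {c d R : A} (cc : c * c = 1) (dd : d * d = 1)
    (dc : d * c = -(c * d)) (dR : d * R = -(R * d)) :
    heckeOfSpin e c d R * c = d * heckeOfSpin e c d R := by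
  unfold heckeOfSpin
  simp only [mul_add, add_mul, mul_sub, sub_mul, smul_mul_assoc, mul_smul_comm, mul_assoc,
    cc, dd, dc, dR, reassoc cc, reassoc dd, reassoc dc, reassoc dR,
    one_mul, mul_one, neg_mul, mul_neg, neg_neg, smul_neg]
  module

theorem heckeOfSpin_mul_far {e : K} {c d f R : A} (fc : f * c = -(c * f)) (fd : f * d = -(d * f))
    (fR : f * R = -(R * f)) :
    heckeOfSpin e c d R * f = f * heckeOfSpin e c d R := by
  unfold heckeOfSpin
  simp only [mul_add, add_mul, mul_sub, sub_mul, smul_mul_assoc, mul_smul_comm, mul_assoc,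
    fc, fd, fR, reassoc fc, reassoc fd, reassoc fR,
    one_mul, mul_one, neg_mul, mul_neg, neg_neg, smul_neg]

/-- Since `T - e` is the inverse of `T`, this is the relation `(T + e c d) X T = X'` multiplied on
the right by `T⁻¹`; in this form it is linear in the Hecke element on each side. -/
theorem heckeOfSpin_mul_X {e : K} {c d R p q p' q' : A} (cc : c * c = 1) (dd : d * d = 1)
    (dc : d * c = -(c * d)) (dR : d * R = -(R * d))
    (cp : c * p = p * c) (dp : d * p = p * d) (cq : c * q = -(q * c)) (dq : d * q = -(q * d))
    (dq' : d * q' = -(q' * d))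
    (Rp : R * p = p' * R + e • (q - q')) (Rq : R * q = -(q' * R) - e • (p + p')) :
    (heckeOfSpin e c d R + e • (c * d)) * (p - c * q) =
      (p' - d * q') * (heckeOfSpin e c d R - e • 1) := by
  unfold heckeOfSpin
  simp only [mul_add, add_mul, mul_sub, sub_mul, smul_mul_assoc, mul_smul_comm, mul_assoc,
    cc, dd, dc, dR, cp, dp, cq, dq, dq', Rp, Rq, reassoc cc, reassoc dd, reassoc dc, reassoc dR,
    reassoc cp, reassoc dp, reassoc cq, reassoc dq, reassoc dq', reassoc Rp, reassoc Rq,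
    one_mul, mul_one, neg_mul, mul_neg, neg_neg, smul_neg, smul_sub, smul_add]
  module

theorem heckeOfSpin_mul_X_far {e : K} {c d f R p q : A}
    (fc : f * c = -(c * f)) (fd : f * d = -(d * f)) (fR : f * R = -(R * f))
    (cp : c * p = p * c) (dp : d * p = p * d)
    (cq : c * q = -(q * c)) (dq : d * q = -(q * d))
    (Rp : R * p = p * R) (Rq : R * q = -(q * R)) (fq : f * q = -(q * f)) :
    heckeOfSpin e c d R * (p - f * q) = (p - f * q) * heckeOfSpin e c d R := by
  unfold heckeOfSpin
  simp only [mul_add, add_mul, mul_sub, sub_mul, smul_mul_assoc, mul_smul_comm, mul_assoc,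
    fc, fd, fR, cp, dp, cq, dq, Rp, Rq, fq, reassoc fc, reassoc fd, reassoc fR,
    reassoc cp, reassoc dp, reassoc cq, reassoc dq, reassoc Rp, reassoc Rq, reassoc fq,
    one_mul, mul_one, neg_mul, mul_neg, neg_neg, smul_neg]
  module

/-- The expression of the spin generator through the Hecke generator and Clifford generators. -/
def spinOfHecke (e : K) (c d T : A) : A := (c - d) * T + e • d

/-- Multiply `T c = d T` on both sides by `T⁻¹ = T - e` to get `c (T - e) = (T - e) d`. The
presentation only moves `T` past the left Clifford generator; this moves it past the right one, with
a correction term. -/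
theorem T_mul_right {e : K} {c d T : A} (TT : T * T = e • T + 1) (Tc : T * c = d * T) :
    T * d = c * T + e • (d - c) := by
  have h : (T - e • 1) * T = 1 := by rw [sub_mul, TT]; simp
  have h' : T * (T - e • 1) = 1 := by rw [mul_sub, TT]; simp
  have h2 : (T - e • 1) * (T * c) * (T - e • 1) = (T - e • 1) * (d * T) * (T - e • 1) := by rw [Tc]
  rw [← mul_assoc (T - e • 1), h, one_mul, mul_assoc, mul_assoc, h', mul_one] at h2
  simp only [mul_sub, sub_mul, smul_mul_assoc, mul_smul_comm, mul_one, one_mul] at h2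
  rw [sub_eq_iff_eq_add] at h2
  rw [← sub_eq_zero] at h2 ⊢
  rw [← neg_eq_zero, ← h2]
  module

theorem spinOfHecke_sq {e : K} {c d T : A} (cc : c * c = 1) (dd : d * d = 1)
    (dc : d * c = -(c * d)) (TT : T * T = e • T + 1) (Tc : T * c = d * T) :
    spinOfHecke e c d T * spinOfHecke e c d T = (-e ^ 2 - 2) • (1 : A) := by
  have Td := T_mul_right TT Tc
  unfold spinOfHecke
  simp only [mul_add, add_mul, mul_sub, sub_mul, smul_mul_assoc, mul_smul_comm, mul_assoc,
    cc, dd, dc, TT, Tc, Td, reassoc cc, reassoc dd, reassoc dc, reassoc TT, reassoc Tc, reassoc Td,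
    one_mul, mul_one, neg_mul, mul_neg, neg_neg, smul_neg, smul_sub, smul_add]
  module

theorem spinOfHecke_braid {e : K} {c d f T U : A} (cc : c * c = 1) (dd : d * d = 1)
    (ff : f * f = 1)
    (dc : d * c = -(c * d)) (fc : f * c = -(c * f)) (fd : f * d = -(d * f))
    (TT : T * T = e • T + 1) (Tc : T * c = d * T) (Tf : T * f = f * T)
    (UU : U * U = e • U + 1) (Ud : U * d = f * U) (Uc : U * c = c * U)
    (UTU : U * (T * U) = T * (U * T)) :
    spinOfHecke e c d T * spinOfHecke e d f U * spinOfHecke e c d T -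
      spinOfHecke e d f U * spinOfHecke e c d T * spinOfHecke e d f U =
      e ^ 2 • (spinOfHecke e d f U - spinOfHecke e c d T) := by
  have Td := T_mul_right TT Tc
  have Uf := T_mul_right UU Ud
  have UTU' : ∀ x, U * (T * (U * x)) = T * (U * (T * x)) := by
    intro x
    have := congrArg (· * x) UTU
    simpa only [mul_assoc] using this
  unfold spinOfHecke
  simp only [mul_add, add_mul, mul_sub, sub_mul, smul_mul_assoc, mul_smul_comm, mul_assoc,
    cc, dd, dc, TT, Tc, Td, reassoc cc, reassoc dd, reassoc dc, reassoc TT, reassoc Tc, reassoc Td,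
    ff, fc, fd, Tf, UU, Ud, Uc, Uf, reassoc ff, reassoc fc, reassoc fd, reassoc Tf, reassoc UU,
    reassoc Ud, reassoc Uc, reassoc Uf, UTU, UTU',
    one_mul, mul_one, neg_mul, mul_neg, neg_neg, smul_neg, smul_sub, smul_add]
  module

theorem spinOfHecke_far {e : K} {c d f g T U : A}
    (fc : f * c = -(c * f)) (fd : f * d = -(d * f))
    (gc : g * c = -(c * g)) (gd : g * d = -(d * g))
    (Uc : U * c = c * U) (Ud : U * d = d * U)
    (Tf : T * f = f * T) (Tg : T * g = g * T) (UT : U * T = T * U) :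
    spinOfHecke e c d T * spinOfHecke e f g U =
      -(spinOfHecke e f g U * spinOfHecke e c d T) := by
  unfold spinOfHecke
  simp only [mul_add, add_mul, mul_sub, sub_mul, smul_mul_assoc, mul_smul_comm, mul_assoc,
    fc, fd, gc, gd, Uc, Ud, Tf, Tg, UT, reassoc fc, reassoc fd, reassoc gc, reassoc gd,
    reassoc Uc, reassoc Ud, reassoc Tf, reassoc Tg, reassoc UT,
    one_mul, mul_one, neg_mul, mul_neg, neg_neg, smul_neg]
  module

/-- The expression of `p` through `X` and `X⁻¹`. -/
def pOfX (K : Type*) [Field K] {A : Type*} [Ring A] [Algebra K A] (X Y : A) : A :=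
  (2⁻¹ : K) • (X + Y)

/-- The expression of `q` through `X`, `X⁻¹` and the Clifford generator. -/
def qOfX (K : Type*) [Field K] {A : Type*} [Ring A] [Algebra K A] (X Y c : A) : A :=
  (2⁻¹ : K) • ((X - Y) * c)

/-- Right multiplication of the defining relation by `T⁻¹ = T - e` turns it into a rule moving `T`
to the right of `X`. -/
theorem T_mul_X {e : K} {c d T X X' : A} (TT : T * T = e • T + 1)
    (TXT : (T + e • (c * d)) * X * T = X') :
    T * X = X' * T - e • X' - e • (c * (d * X)) := by
  have h' : T * (T - e • 1) = 1 := by rw [mul_sub, TT]; simp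
  have h2 : (T + e • (c * d)) * X = X' * (T - e • 1) := by
    rw [← TXT, mul_assoc, h', mul_one]
  rw [add_mul, smul_mul_assoc, mul_assoc, mul_sub, mul_smul_comm, mul_one] at h2
  rw [← h2]
  module

/-- The Clifford generator conjugates `X` into `Y`, i.e. `Y = c X c`, so `T Y = d (T X) c` and
`T_mul_X` applies. Nothing is inverted: that `Y` is the inverse of `X` plays no role here. -/
theorem T_mul_Xinv {e : K} {c d T X Y X' Y' : A} (cc : c * c = 1) (dd : d * d = 1)
    (dc : d * c = -(c * d)) (TT : T * T = e • T + 1) (Tc : T * c = d * T)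
    (TXT : (T + e • (c * d)) * X * T = X')
    (Xc : X * c = c * Y) (Xc' : X' * c = c * X') (Xd' : X' * d = d * Y') :
    T * Y = Y' * T + e • (c * (d * X')) + e • Y := by
  have hY : Y = c * (X * c) := by rw [Xc, ← mul_assoc, cc, one_mul]
  have TX := T_mul_X TT TXT
  have h : T * Y = d * (T * X * c) := by rw [hY]; simp only [← mul_assoc, Tc]
  rw [h, TX]
  simp only [mul_add, add_mul, mul_sub, sub_mul, smul_mul_assoc, mul_smul_comm, mul_assoc,
    cc, dd, dc, Tc, reassoc cc, reassoc dd, reassoc dc, reassoc Tc,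
    Xc, Xc', Xd', reassoc Xc, reassoc Xc', reassoc Xd',
    one_mul, mul_one, neg_mul, mul_neg, neg_neg, smul_neg, smul_sub, smul_add]
  module

theorem spinOfHecke_mul_p {e : K} {c d T X Y X' Y' : A} (cc : c * c = 1) (dd : d * d = 1)
    (dc : d * c = -(c * d)) (TT : T * T = e • T + 1) (Tc : T * c = d * T)
    (TXT : (T + e • (c * d)) * X * T = X')
    (Xc : X * c = c * Y) (Yc : Y * c = c * X) (Xc' : X' * c = c * X') (Yc' : Y' * c = c * Y')
    (Xd' : X' * d = d * Y') (Yd' : Y' * d = d * X') :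
    spinOfHecke e c d T * pOfX K X Y = pOfX K X' Y' * spinOfHecke e c d T +
      e • (qOfX K X Y c - qOfX K X' Y' d) := by
  have TX := T_mul_X TT TXT
  have TY := T_mul_Xinv cc dd dc TT Tc TXT Xc Xc' Xd'
  unfold spinOfHecke pOfX qOfX
  simp only [mul_add, add_mul, mul_sub, sub_mul, smul_mul_assoc, mul_smul_comm, mul_assoc,
    cc, dd, dc, reassoc cc, reassoc dd, reassoc dc,
    Tc, reassoc Tc, TX, TY, reassoc TX, reassoc TY,
    Xc, Yc, Xc', Yc', Xd', Yd', reassoc Xc, reassoc Yc, reassoc Xc', reassoc Yc',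
    reassoc Xd', reassoc Yd',
    one_mul, mul_one, neg_mul, mul_neg, neg_neg, smul_neg, smul_sub, smul_add]
  module

theorem spinOfHecke_mul_q {e : K} {c d T X Y X' Y' : A} (cc : c * c = 1) (dd : d * d = 1)
    (dc : d * c = -(c * d)) (TT : T * T = e • T + 1) (Tc : T * c = d * T)
    (TXT : (T + e • (c * d)) * X * T = X')
    (Xc : X * c = c * Y) (Yc : Y * c = c * X) (Xc' : X' * c = c * X') (Yc' : Y' * c = c * Y')
    (Xd' : X' * d = d * Y') (Yd' : Y' * d = d * X') :
    spinOfHecke e c d T * qOfX K X Y c = -(qOfX K X' Y' d * spinOfHecke e c d T) -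
      e • (pOfX K X Y + pOfX K X' Y') := by
  have TX := T_mul_X TT TXT
  have TY := T_mul_Xinv cc dd dc TT Tc TXT Xc Xc' Xd'
  unfold spinOfHecke pOfX qOfX
  simp only [mul_add, add_mul, mul_sub, sub_mul, smul_mul_assoc, mul_smul_comm, mul_assoc,
    cc, dd, dc, reassoc cc, reassoc dd, reassoc dc,
    Tc, reassoc Tc, TX, TY, reassoc TX, reassoc TY,
    Xc, Yc, Xc', Yc', Xd', Yd', reassoc Xc, reassoc Yc, reassoc Xc', reassoc Yc',
    reassoc Xd', reassoc Yd',
    one_mul, mul_one, neg_mul, mul_neg, neg_neg, smul_neg, smul_sub, smul_add]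
  module

theorem spinOfHecke_mul_p_far {e : K} {c d T X Y : A} (TX : T * X = X * T) (TY : T * Y = Y * T)
    (Xc : X * c = c * X) (Yc : Y * c = c * Y) (Xd : X * d = d * X) (Yd : Y * d = d * Y) :
    spinOfHecke e c d T * pOfX K X Y = pOfX K X Y * spinOfHecke e c d T := by
  unfold spinOfHecke pOfX
  simp only [mul_add, add_mul, mul_sub, sub_mul, smul_mul_assoc, mul_smul_comm, mul_assoc,
    TX, TY, Xc, Yc, Xd, Yd, reassoc TX, reassoc TY, reassoc Xc, reassoc Yc, reassoc Xd, reassoc Yd]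
  module

theorem spinOfHecke_mul_q_far {e : K} {c d f T X Y : A} (TX : T * X = X * T) (TY : T * Y = Y * T)
    (Tf : T * f = f * T) (fc : f * c = -(c * f)) (fd : f * d = -(d * f))
    (Xc : X * c = c * X) (Yc : Y * c = c * Y) (Xd : X * d = d * X) (Yd : Y * d = d * Y)
    (Xf : X * f = f * Y) (Yf : Y * f = f * X) :
    spinOfHecke e c d T * qOfX K X Y f = -(qOfX K X Y f * spinOfHecke e c d T) := by
  unfold spinOfHecke qOfX
  simp only [mul_add, add_mul, mul_sub, sub_mul, smul_mul_assoc, mul_smul_comm, mul_assoc,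
    TX, TY, Tf, fc, fd, Xc, Yc, Xd, Yd, Xf, Yf, reassoc TX, reassoc TY, reassoc Tf, reassoc fc,
    reassoc fd, reassoc Xc, reassoc Yc, reassoc Xd, reassoc Yd, reassoc Xf, reassoc Yf,
    neg_mul, mul_neg, neg_neg]
  module

theorem X_X_of_spin {c d p q p' q' : A} (dc : d * c = -(c * d)) (qq : q' * q = -(q * q'))
    (cp : c * p' = p' * c) (dp : d * p = p * d) (cq : c * q' = -(q' * c)) (dq : d * q = -(q * d))
    (pp : p' * p = p * p') (pq : p * q' = q' * p) (pq' : p' * q = q * p') :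
    (p - c * q) * (p' - d * q') = (p' - d * q') * (p - c * q) := by
  have qc : q' * c = -(c * q') := by rw [cq, neg_neg]
  have qd : q * d = -(d * q) := by rw [dq, neg_neg]
  simp only [mul_sub, sub_mul, mul_assoc, dc, qq, qc, qd, pp, ← pq, pq', ← cp, dp,
    reassoc dc, reassoc qq, reassoc qc, reassoc qd, reassoc pp, reassoc pq.symm, reassoc pq',
    reassoc cp.symm, reassoc dp, neg_mul, mul_neg, neg_neg]
  abel

/-- The mixed terms cancel and `(cq)² = -q²`, so the product is `p² + q²`: the circle equation is
the invertibility of `X`. -/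
theorem X_Xi_of_spin {c p q : A} (cc : c * c = 1) (cp : c * p = p * c) (cq : c * q = -(q * c))
    (pq : p * q = q * p) (circle : p * p + q * q = 1) : (p - c * q) * (p + c * q) = 1 := by
  have qc : q * c = -(c * q) := by rw [cq, neg_neg]
  rw [← circle]
  simp only [mul_add, sub_mul, mul_assoc, reassoc cc, qc, reassoc qc, ← pq, reassoc cp.symm,
    neg_mul, mul_neg, one_mul]
  abel

theorem Xi_X_of_spin {c p q : A} (cc : c * c = 1) (cp : c * p = p * c) (cq : c * q = -(q * c))
    (pq : p * q = q * p) (circle : p * p + q * q = 1) : (p + c * q) * (p - c * q) = 1 := by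
  have qc : q * c = -(c * q) := by rw [cq, neg_neg]
  rw [← circle]
  simp only [mul_sub, add_mul, mul_assoc, reassoc cc, qc, reassoc qc, ← pq, reassoc cp.symm,
    neg_mul, mul_neg, one_mul]
  abel

theorem X_c_of_spin {c p q : A} (cp : c * p = p * c) (cq : c * q = -(q * c)) :
    (p - c * q) * c = c * (p + c * q) := by
  have qc : q * c = -(c * q) := by rw [cq, neg_neg]
  rw [sub_mul, ← cp, mul_assoc, qc, mul_neg, sub_neg_eq_add, mul_add]

theorem X_c_far_of_spin {c d p q : A} (dc : d * c = -(c * d)) (dp : d * p = p * d)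
    (dq : d * q = -(q * d)) : (p - c * q) * d = d * (p - c * q) := by
  simp only [mul_sub, sub_mul, mul_assoc, dp, dq, reassoc dc, mul_neg, neg_mul, neg_neg]

theorem hecke_quadratic {t : K} (ht : t ≠ 0) {T : A} (TT : T * T = (t - t⁻¹) • T + 1) :
    (T - algebraMap K A t) * (T + algebraMap K A t⁻¹) = 0 := by
  have h : algebraMap K A t * algebraMap K A t⁻¹ = 1 := by
    rw [← map_mul, mul_inv_cancel₀ ht, map_one]
  rw [mul_add, sub_mul, sub_mul, TT, h, sub_smul, ← Algebra.commutes t⁻¹, Algebra.smul_def,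
    Algebra.smul_def]
  abel

theorem hecke_sq {t : K} (ht : t ≠ 0) {T : A}
    (h0 : (T - algebraMap K A t) * (T + algebraMap K A t⁻¹) = 0) :
    T * T = (t - t⁻¹) • T + 1 := by
  have h : algebraMap K A t * algebraMap K A t⁻¹ = 1 := by
    rw [← map_mul, mul_inv_cancel₀ ht, map_one]
  rw [mul_add, sub_mul, sub_mul, h, ← Algebra.commutes t⁻¹] at h0
  rw [sub_smul, Algebra.smul_def, Algebra.smul_def, ← sub_eq_zero, ← h0]
  abel

theorem heckeOfSpin_spinOfHecke {e : K} {c d T : A} (cc : c * c = 1) (dd : d * d = 1)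
    (dc : d * c = -(c * d)) (TT : T * T = e • T + 1) (Tc : T * c = d * T) :
    heckeOfSpin e c d (spinOfHecke e c d T) = T := by
  have Td := T_mul_right TT Tc
  unfold heckeOfSpin spinOfHecke
  simp only [mul_add, add_mul, mul_sub, sub_mul, smul_mul_assoc, mul_smul_comm, mul_assoc,
    cc, dd, dc, Tc, Td, reassoc cc, reassoc dd, reassoc dc, reassoc Tc, reassoc Td,
    one_mul, mul_one, neg_mul, mul_neg, neg_neg, smul_neg, smul_sub, smul_add]
  module

theorem spinOfHecke_heckeOfSpin {e : K} {c d R : A} (cc : c * c = 1) (dd : d * d = 1)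
    (dc : d * c = -(c * d)) (cR : c * R = -(R * c)) (dR : d * R = -(R * d)) :
    spinOfHecke e c d (heckeOfSpin e c d R) = R := by
  unfold heckeOfSpin spinOfHecke
  simp only [mul_add, add_mul, mul_sub, sub_mul, smul_mul_assoc, mul_smul_comm, mul_assoc,
    cc, dd, dc, cR, dR, reassoc cc, reassoc dd, reassoc dc, reassoc cR, reassoc dR,
    one_mul, mul_one, neg_mul, mul_neg, neg_neg, smul_neg, smul_sub, smul_add]
  module

theorem pOfX_eq {c p q : A} : pOfX K (p - c * q) (p + c * q) = p := by
  unfold pOfX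
  module

theorem qOfX_eq {c p q : A} (cc : c * c = 1) (cq : c * q = -(q * c)) :
    qOfX K (p - c * q) (p + c * q) c = q := by
  unfold qOfX
  have h : p - c * q - (p + c * q) = (2 : K) • (q * c) := by rw [cq]; module
  rw [h, smul_mul_assoc, mul_assoc, cc, mul_one, smul_smul, inv_mul_cancel₀ two_ne_zero, one_smul]

theorem pOfX_sub {c X Y : A} (cc : c * c = 1) (Xc : X * c = c * Y) (Yc : Y * c = c * X) :
    pOfX K X Y - c * qOfX K X Y c = X := by
  unfold pOfX qOfX
  rw [mul_smul_comm, sub_mul, Xc, Yc, mul_sub, ← mul_assoc, ← mul_assoc, cc, one_mul, one_mul]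
  module

theorem pOfX_add {c X Y : A} (cc : c * c = 1) (Xc : X * c = c * Y) (Yc : Y * c = c * X) :
    pOfX K X Y + c * qOfX K X Y c = Y := by
  unfold pOfX qOfX
  rw [mul_smul_comm, sub_mul, Xc, Yc, mul_sub, ← mul_assoc, ← mul_assoc, cc, one_mul, one_mul]
  module

/-- Moving `c` across `X - Y` changes its sign, so `q² = -((X - Y)/2)²`, and the difference of the
two squares is `XY = 1`. -/
theorem circle_of_X {c X Y : A} (cc : c * c = 1) (Xc : X * c = c * Y) (Yc : Y * c = c * X)
    (XY : X * Y = 1) (YX : Y * X = 1) :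
    pOfX K X Y * pOfX K X Y + qOfX K X Y c * qOfX K X Y c = 1 := by
  have cX : c * X = Y * c := Yc.symm
  have cY : c * Y = X * c := Xc.symm
  unfold pOfX qOfX
  simp only [mul_add, add_mul, mul_sub, sub_mul, smul_mul_assoc, mul_smul_comm, mul_assoc,
    reassoc cX, reassoc cY, cc, XY, YX, mul_one, smul_add, smul_sub]
  module

theorem p_q_of_X {c X Y : A} (Xc : X * c = c * Y) (Yc : Y * c = c * X)
    (XY : X * Y = 1) (YX : Y * X = 1) :
    pOfX K X Y * qOfX K X Y c = qOfX K X Y c * pOfX K X Y := by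
  have cX : c * X = Y * c := Yc.symm
  have cY : c * Y = X * c := Xc.symm
  unfold pOfX qOfX
  simp only [mul_add, add_mul, mul_sub, sub_mul, smul_mul_assoc, mul_smul_comm, mul_assoc,
    cX, cY, reassoc XY, reassoc YX, one_mul, smul_add, smul_sub]
  module

theorem p_p_of_X {X Y X' Y' : A} (h1 : Commute X X') (h2 : Commute X Y') (h3 : Commute Y X')
    (h4 : Commute Y Y') : pOfX K X Y * pOfX K X' Y' = pOfX K X' Y' * pOfX K X Y :=
  (((h1.add_right h2).add_left (h3.add_right h4)).smul_left _).smul_right _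

theorem p_q_far_of_X {d X Y X' Y' : A} (h1 : Commute X X') (h2 : Commute X Y') (h3 : Commute Y X')
    (h4 : Commute Y Y') (h5 : Commute X d) (h6 : Commute Y d) :
    pOfX K X Y * qOfX K X' Y' d = qOfX K X' Y' d * pOfX K X Y :=
  (((((h1.sub_right h2).add_left (h3.sub_right h4))).mul_right
    (h5.add_left h6)).smul_left _).smul_right _

theorem q_q_of_X {c d X Y X' Y' : A} (dc : d * c = -(c * d)) (h1 : Commute X X')
    (h2 : Commute X Y') (h3 : Commute Y X') (h4 : Commute Y Y') (h5 : Commute X d)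
    (h6 : Commute Y d) (h7 : Commute X' c) (h8 : Commute Y' c) :
    qOfX K X Y c * qOfX K X' Y' d = -(qOfX K X' Y' d * qOfX K X Y c) := by
  have e1 : (X - Y) * (X' - Y') = (X' - Y') * (X - Y) :=
    (h1.sub_right h2).sub_left (h3.sub_right h4)
  have e2 : (X - Y) * d = d * (X - Y) := h5.sub_left h6
  have e3 : (X' - Y') * c = c * (X' - Y') := h7.sub_left h8
  unfold qOfX
  rw [smul_mul_smul_comm, smul_mul_smul_comm, ← smul_neg, mul_assoc, ← mul_assoc c, ← e3,
    mul_assoc (X' - Y'), ← mul_assoc (X - Y), e1, mul_assoc (X' - Y') d, ← mul_assoc d, ← e2,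
    mul_assoc (X - Y), dc, mul_neg, mul_neg, neg_neg, mul_assoc]

/-- With the next two lemmas this shows that the image of a spin generator `Rᵢ` anticommutes with
all Clifford generators, as the gluing of `Ψ` over the graded tensor product requires. -/
theorem left_mul_spinOfHecke {e : K} {c d T : A} (cc : c * c = 1) (dd : d * d = 1)
    (dc : d * c = -(c * d)) (Tc : T * c = d * T) :
    c * spinOfHecke e c d T = -(spinOfHecke e c d T * c) := by
  unfold spinOfHecke
  simp only [mul_add, add_mul, mul_sub, sub_mul, smul_mul_assoc, mul_smul_comm, mul_assoc,
    cc, dd, dc, Tc, reassoc cc, reassoc dd, reassoc dc, one_mul, neg_mul, smul_neg]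
  module

theorem right_mul_spinOfHecke {e : K} {c d T : A} (cc : c * c = 1) (dd : d * d = 1)
    (dc : d * c = -(c * d)) (TT : T * T = e • T + 1) (Tc : T * c = d * T) :
    d * spinOfHecke e c d T = -(spinOfHecke e c d T * d) := by
  have Td := T_mul_right TT Tc
  unfold spinOfHecke
  simp only [mul_add, add_mul, mul_sub, sub_mul, smul_mul_assoc, mul_smul_comm, mul_assoc,
    cc, dd, dc, Td, reassoc cc, reassoc dd, reassoc dc, one_mul, neg_mul, smul_neg]
  module

theorem far_mul_spinOfHecke {e : K} {c d f T : A} (fc : f * c = -(c * f)) (fd : f * d = -(d * f))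
    (Tf : T * f = f * T) : f * spinOfHecke e c d T = -(spinOfHecke e c d T * f) := by
  unfold spinOfHecke
  simp only [mul_add, add_mul, mul_sub, sub_mul, smul_mul_assoc, mul_smul_comm, mul_assoc,
    fc, fd, Tf, reassoc fc, reassoc fd, neg_mul, smul_neg]
  module

end Generic

/-! ### The homomorphisms between the affine algebras and their compatibility with parity. -/

section Maps

variable {m : ℕ}

theorem cliffC_sq (i : Fin (m + 1)) : cliffC i * cliffC i = 1 := by
  rw [cliffC, CliffordAlgebra.ι_sq_scalar, QuadraticMap.weightedSumSquares_apply,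
    Finset.sum_eq_single i]
  · simp
  · intro j _ hj; simp [Pi.single_eq_of_ne hj]
  · simp

theorem cliffC_anticomm {i j : Fin (m + 1)} (h : i ≠ j) :
    cliffC i * cliffC j = -(cliffC j * cliffC i) := by
  refine CliffordAlgebra.ι_mul_ι_comm_of_isOrtho ?_
  rw [QuadraticMap.isOrtho_def]
  simp only [QuadraticMap.weightedSumSquares_apply, one_smul, ← Finset.sum_add_distrib]
  refine Finset.sum_congr rfl fun l _ => ?_
  by_cases hi : l = i
  · subst hi; simp [Pi.single_eq_of_ne h]
  · simp [Pi.single_eq_of_ne hi]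

theorem cliffC_mem (i : Fin (m + 1)) : cliffC i ∈ cliffGr m 1 :=
  CliffordAlgebra.ι_mem_evenOdd_one _ _

theorem ι_eq_sum_cliffC (v : Fin (m + 1) → Kq) :
    CliffordAlgebra.ι (cliffForm m) v = ∑ i, v i • cliffC i := by
  simp only [cliffC, ← map_smul, ← map_sum]
  congr 1
  ext j
  simp [Finset.sum_apply, Pi.single_apply]

/-- Translates the integer units occurring as signs in graded tensor products into the scalars
`sgn`. -/
theorem zpow_sgn_smul {A : Type*} [AddCommGroup A] [Module Kq A] (i : ZMod 2) (a : A) :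
    ((-1 : ℤˣ) ^ i) • a = sgn Kq i • a := by
  rcases zcases i with rfl | rfl
  · simp
  · rw [uzpow_one]; simp [Units.smul_def]

/-- The identity of the tensor product corresponds, under its universal property, to the pair of
inclusions; the condition carried by that pair is the sign rule. -/
theorem inC_mul_inS {i j : ZMod 2} {a : Cliff m} {b : AffSpin m} (ha : a ∈ cliffGr m i)
    (hb : b ∈ AffSpin.gr m j) : inC a * inS b = sgn Kq (j * i) • (inS b * inC a) := by
  rw [← zpow_sgn_smul]
  exact ((GradedTensorProduct.liftEquiv (cliffGr m) (AffSpin.gr m)).symm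
    (AlgHom.id Kq (CliffSpin m))).2 ⟨a, ha⟩ ⟨b, hb⟩

theorem tmul_eq (a : Cliff m) (b : AffSpin m) :
    (a ᵍ⊗ₜ[Kq] b : CliffSpin m) = inC a * inS b :=
  (GradedTensorProduct.tmul_one_mul_one_tmul (cliffGr m) (AffSpin.gr m) a b).symm

theorem R_mem (i : Fin m) : AffSpin.R i ∈ AffSpin.gr m 1 := by
  rw [mem_superGr, AffSpin.parity_R]; simp
theorem p_mem (i : Fin (m + 1)) : AffSpin.p i ∈ AffSpin.gr m 0 := by
  rw [mem_superGr, AffSpin.parity_p]; simp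
theorem q_mem (i : Fin (m + 1)) : AffSpin.q i ∈ AffSpin.gr m 1 := by
  rw [mem_superGr, AffSpin.parity_q]; simp

/-! ### The generators of the tensor product -/

namespace CliffSpin

/-- The generator `cᵢ` of the tensor product. -/
def c (i : Fin (m + 1)) : CliffSpin m := inC (cliffC i)
/-- The generator `Rᵢ` of the tensor product. -/
def R (i : Fin m) : CliffSpin m := inS (AffSpin.R i)
/-- The generator `pᵢ` of the tensor product. -/
def p (i : Fin (m + 1)) : CliffSpin m := inS (AffSpin.p i)
/-- The generator `qᵢ` of the tensor product. -/
def q (i : Fin (m + 1)) : CliffSpin m := inS (AffSpin.q i)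

theorem c_sq (i : Fin (m + 1)) : (c i * c i : CliffSpin m) = 1 := by
  rw [c, ← map_mul, cliffC_sq, map_one]

theorem c_c {i j : Fin (m + 1)} (h : i ≠ j) : (c i * c j : CliffSpin m) = -(c j * c i) := by
  rw [c, c, ← map_mul, cliffC_anticomm h, map_neg, map_mul]

theorem c_R (i : Fin (m + 1)) (j : Fin m) : c i * R j = -(R j * c i) := by
  rw [c, R, inC_mul_inS (cliffC_mem i) (R_mem j)]; simp

theorem c_p (i j : Fin (m + 1)) : c i * p j = p j * c i := by
  rw [c, p, inC_mul_inS (cliffC_mem i) (p_mem j)]; simp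

theorem c_q (i j : Fin (m + 1)) : c i * q j = -(q j * c i) := by
  rw [c, q, inC_mul_inS (cliffC_mem i) (q_mem j)]; simp

theorem R_sq (i : Fin m) : R i * R i = (-eps ^ 2 - 2) • (1 : CliffSpin m) := by
  have h := congrArg inS (AffSpin.mk_rel (SpinRel.R_sq i))
  simp only [map_mul, Algebra.algebraMap_eq_smul_one, map_smul, map_one] at h
  exact h

theorem R_far {i j : Fin m} (h : (i : ℕ) + 1 < j ∨ (j : ℕ) + 1 < i) :
    (R i * R j : CliffSpin m) = -(R j * R i) := by
  have h := congrArg inS (AffSpin.mk_rel (SpinRel.R_far i j h))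
  simp only [map_mul, map_neg] at h
  exact h

theorem braid {i j : Fin m} (h : (j : ℕ) = i + 1) :
    (R i * R j * R i - R j * R i * R j : CliffSpin m) = eps ^ 2 • (R j - R i) := by
  have h := congrArg inS (AffSpin.mk_rel (SpinRel.braid i j h))
  simp only [map_mul, map_sub, map_smul] at h
  exact h

theorem p_p (i j : Fin (m + 1)) : (p i * p j : CliffSpin m) = p j * p i := by
  have h := congrArg inS (AffSpin.mk_rel (SpinRel.p_p i j))
  simp only [map_mul] at h
  exact h

theorem q_q {i j : Fin (m + 1)} (h : i ≠ j) : (q i * q j : CliffSpin m) = -(q j * q i) := by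
  have h := congrArg inS (AffSpin.mk_rel (SpinRel.q_q i j h))
  simp only [map_mul, map_neg] at h
  exact h

theorem circle (i : Fin (m + 1)) : (p i * p i + q i * q i : CliffSpin m) = 1 := by
  have h := congrArg inS (AffSpin.mk_rel (SpinRel.circle i))
  simp only [map_mul, map_add, map_one] at h
  exact h

theorem p_q (i j : Fin (m + 1)) : (p i * q j : CliffSpin m) = q j * p i := by
  have h := congrArg inS (AffSpin.mk_rel (SpinRel.p_q i j))
  simp only [map_mul] at h
  exact h

theorem R_p_far {i : Fin m} {j : Fin (m + 1)} (h : j ≠ i.castSucc) (h' : j ≠ i.succ) :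
    R i * p j = p j * R i := by
  have h := congrArg inS (AffSpin.mk_rel (SpinRel.R_p_far i j h h'))
  simp only [map_mul] at h
  exact h

theorem R_q_far {i : Fin m} {j : Fin (m + 1)} (h : j ≠ i.castSucc) (h' : j ≠ i.succ) :
    R i * q j = -(q j * R i) := by
  have h := congrArg inS (AffSpin.mk_rel (SpinRel.R_q_far i j h h'))
  simp only [map_mul, map_neg] at h
  exact h

theorem R_p (i : Fin m) :
    R i * p i.castSucc = p i.succ * R i + eps • (q i.castSucc - q i.succ) := by
  have h := congrArg inS (AffSpin.mk_rel (SpinRel.R_p i))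
  simp only [map_mul, map_add, map_sub, map_smul] at h
  exact h

theorem R_q (i : Fin m) :
    R i * q i.castSucc = -(q i.succ * R i) - eps • (p i.castSucc + p i.succ) := by
  have h := congrArg inS (AffSpin.mk_rel (SpinRel.R_q i))
  simp only [map_mul, map_add, map_sub, map_neg, map_smul] at h
  exact h

/-- The image of `Tᵢ`. -/
def T (i : Fin m) : CliffSpin m := heckeOfSpin eps (c i.castSucc) (c i.succ) (R i)

theorem succ_ne (i : Fin m) : i.succ ≠ i.castSucc := i.castSucc_lt_succ.ne'

theorem T_sq (i : Fin m) : T i * T i = eps • T i + 1 :=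
  heckeOfSpin_sq (c_sq _) (c_sq _) (c_c (succ_ne i)) (c_R _ _) (c_R _ _) (R_sq i)

theorem T_braid {i j : Fin m} (h : (j : ℕ) = i + 1) :
    (T i * T j * T i : CliffSpin m) = T j * T i * T j := by
  -- Consecutive Hecke generators share one Clifford index: the right index of `i` is the left index
  -- of `j`.
  have hj : j.castSucc = i.succ := Fin.ext (by simp [h])
  have h1 : j.succ ≠ i.castSucc := fun h' => by simp [Fin.ext_iff] at h'; omega
  have hb := braid h
  have hb' : R j * (R i * R j) = R i * (R j * R i) - eps ^ 2 • (R j - R i) := by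
    rw [← hb]; simp only [mul_assoc]; abel
  rw [T, T, hj]
  refine heckeOfSpin_braid (c_sq _) (c_sq _) (c_sq _) (c_c (succ_ne i)) (c_c h1)
    (c_c (by rw [← hj]; exact succ_ne j)) (c_R _ _) (c_R _ _) (c_R _ _) (c_R _ _) (c_R _ _)
    (c_R _ _) (R_sq i) (R_sq j) hb'

theorem T_far {i j : Fin m} (h : (i : ℕ) + 1 < j ∨ (j : ℕ) + 1 < i) :
    (T i * T j : CliffSpin m) = T j * T i := by
  refine heckeOfSpin_far (c_c ?_) (c_c ?_) (c_c ?_) (c_c ?_) (c_R _ _) (c_R _ _) (c_R _ _) (c_R _ _)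
    (R_far h.symm)
  all_goals intro h'; simp [Fin.ext_iff] at h'; omega

theorem T_c (i : Fin m) : T i * c i.castSucc = c i.succ * T i :=
  heckeOfSpin_mul_left (c_sq _) (c_sq _) (c_c (succ_ne i)) (c_R _ _)

theorem T_c_far {i : Fin m} {j : Fin (m + 1)} (h : j ≠ i.castSucc) (h' : j ≠ i.succ) :
    T i * c j = c j * T i :=
  heckeOfSpin_mul_far (c_c h) (c_c h') (c_R _ _)

/-- The image of `Xᵢ`. -/
def X (i : Fin (m + 1)) : CliffSpin m := p i - c i * q i
/-- The image of `Xᵢ⁻¹`. -/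
def Xi (i : Fin (m + 1)) : CliffSpin m := p i + c i * q i

theorem T_X_T (i : Fin m) :
    (T i + eps • (c i.castSucc * c i.succ)) * X i.castSucc * T i = X i.succ := by
  have h : (T i + eps • (c i.castSucc * c i.succ)) * X i.castSucc = X i.succ * (T i - eps • 1) :=
    heckeOfSpin_mul_X (c_sq _) (c_sq _) (c_c (succ_ne i)) (c_R _ _) (c_p _ _) (c_p _ _)
    (c_q _ _) (c_q _ _) (c_q _ _) (R_p i) (R_q i)
  rw [h, mul_assoc, sub_mul, T_sq, smul_mul_assoc, one_mul, add_sub_cancel_left, mul_one]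

theorem T_X_far {i : Fin m} {j : Fin (m + 1)} (h : j ≠ i.castSucc) (h' : j ≠ i.succ) :
    T i * X j = X j * T i :=
  heckeOfSpin_mul_X_far (c_c h) (c_c h') (c_R _ _) (c_p _ _) (c_p _ _) (c_q _ _) (c_q _ _)
    (R_p_far h h') (R_q_far h h') (c_q _ _)

theorem X_X (i j : Fin (m + 1)) : (X i * X j : CliffSpin m) = X j * X i := by
  rcases eq_or_ne i j with rfl | h
  · rfl
  exact X_X_of_spin (c_c h.symm) (q_q h.symm) (c_p _ _) (c_p _ _) (c_q _ _) (c_q _ _) (p_p _ _)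
    (p_q _ _) (p_q _ _)

theorem X_Xi (i : Fin (m + 1)) : (X i * Xi i : CliffSpin m) = 1 :=
  X_Xi_of_spin (c_sq _) (c_p _ _) (c_q _ _) (p_q _ _) (circle _)

theorem Xi_X (i : Fin (m + 1)) : (Xi i * X i : CliffSpin m) = 1 :=
  Xi_X_of_spin (c_sq _) (c_p _ _) (c_q _ _) (p_q _ _) (circle _)

theorem X_c (i : Fin (m + 1)) : (X i * c i : CliffSpin m) = c i * Xi i :=
  X_c_of_spin (c_p _ _) (c_q _ _)

theorem X_c_far {i j : Fin (m + 1)} (h : i ≠ j) : (X i * c j : CliffSpin m) = c j * X i :=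
  X_c_far_of_spin (c_c h.symm) (c_p _ _) (c_q _ _)

end CliffSpin

/-- The values of `Φ` on the free generators. -/
def phiGen : HCGen m → CliffSpin m
  | .T i => CliffSpin.T i
  | .c i => CliffSpin.c i
  | .X i => CliffSpin.X i
  | .Xi i => CliffSpin.Xi i

theorem qq_ne_zero : qq ≠ 0 := RatFunc.X_ne_zero

open CliffSpin in
theorem phi_rel ⦃a b : FreeAlgebra Kq (HCGen m)⦄ (h : HCRel m a b) :
    FreeAlgebra.lift Kq (phiGen (m := m)) a = FreeAlgebra.lift Kq (phiGen (m := m)) b := by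
  induction h with
  | hecke i =>
    simp only [map_sub, map_mul, map_add, FreeAlgebra.lift_ι_apply, phiGen, AlgHom.commutes,
      map_zero]
    exact hecke_quadratic qq_ne_zero (T_sq i)
  | braid i j h => simpa [phiGen] using T_braid h
  | far i j h => simpa [phiGen] using T_far h
  | T_c i => simpa [phiGen] using CliffSpin.T_c i
  | T_c_far i j h h' => simpa [phiGen] using CliffSpin.T_c_far h h'
  | c_sq i => simpa [phiGen] using CliffSpin.c_sq i
  | c_c i j h => simpa [phiGen] using CliffSpin.c_c h
  | X_Xi i => simpa [phiGen] using CliffSpin.X_Xi i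
  | Xi_X i => simpa [phiGen] using CliffSpin.Xi_X i
  | T_X_T i => simpa [phiGen] using CliffSpin.T_X_T i
  | T_X_far i j h h' => simpa [phiGen] using CliffSpin.T_X_far h h'
  | X_X i j => simpa [phiGen] using CliffSpin.X_X i j
  | X_c i => simpa [phiGen] using CliffSpin.X_c i
  | X_c_far i j h => simpa [phiGen] using CliffSpin.X_c_far h

/-- The homomorphism `Φ`. -/
def phi (m : ℕ) : AffHC m →ₐ[Kq] CliffSpin m :=
  RingQuot.liftAlgHom Kq ⟨FreeAlgebra.lift Kq (phiGen (m := m)), phi_rel⟩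

theorem phi_mk (x : FreeAlgebra Kq (HCGen m)) :
    phi m (AffHC.mk m x) = FreeAlgebra.lift Kq (phiGen (m := m)) x :=
  RingQuot.liftAlgHom_mkAlgHom_apply Kq _ _ x

theorem phi_T (i : Fin m) : phi m (AffHC.T i) = CliffSpin.T i := by
  rw [AffHC.T, phi_mk, FreeAlgebra.lift_ι_apply]; rfl
theorem phi_c (i : Fin (m + 1)) : phi m (AffHC.c i) = CliffSpin.c i := by
  rw [AffHC.c, phi_mk, FreeAlgebra.lift_ι_apply]; rfl
theorem phi_X (i : Fin (m + 1)) : phi m (AffHC.X i) = CliffSpin.X i := by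
  rw [AffHC.X, phi_mk, FreeAlgebra.lift_ι_apply]; rfl
theorem phi_Xi (i : Fin (m + 1)) : phi m (AffHC.Xi i) = CliffSpin.Xi i := by
  rw [AffHC.Xi, phi_mk, FreeAlgebra.lift_ι_apply]; rfl

/-! ### Relations in the affine Hecke-Clifford algebra -/

namespace AffHC

theorem hecke (i : Fin m) : (T i - algebraMap Kq _ qq) * (T i + algebraMap Kq _ qq⁻¹) = 0 := by
  have h := mk_rel (HCRel.hecke i)
  simp only [map_mul, map_sub, map_add, AlgHom.commutes, map_zero] at h
  exact h

theorem T_sq (i : Fin m) : T i * T i = eps • T i + 1 := hecke_sq qq_ne_zero (hecke i)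

theorem braid {i j : Fin m} (h : (j : ℕ) = i + 1) : T i * T j * T i = T j * T i * T j := by
  have h := mk_rel (HCRel.braid i j h)
  simp only [map_mul] at h
  exact h

theorem far {i j : Fin m} (h : (i : ℕ) + 1 < j ∨ (j : ℕ) + 1 < i) : T i * T j = T j * T i := by
  have h := mk_rel (HCRel.far i j h)
  simp only [map_mul] at h
  exact h

theorem T_c (i : Fin m) : T i * c i.castSucc = c i.succ * T i := by
  have h := mk_rel (HCRel.T_c i)
  simp only [map_mul] at h
  exact h

theorem T_c_far {i : Fin m} {j : Fin (m + 1)} (h : j ≠ i.castSucc) (h' : j ≠ i.succ) :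
    T i * c j = c j * T i := by
  have h := mk_rel (HCRel.T_c_far i j h h')
  simp only [map_mul] at h
  exact h

theorem c_sq (i : Fin (m + 1)) : c i * c i = 1 := by
  have h := mk_rel (HCRel.c_sq i)
  simp only [map_mul, map_one] at h
  exact h

theorem c_c {i j : Fin (m + 1)} (h : i ≠ j) : c i * c j = -(c j * c i) := by
  have h := mk_rel (HCRel.c_c i j h)
  simp only [map_mul, map_neg] at h
  exact h

theorem X_Xi (i : Fin (m + 1)) : X i * Xi i = 1 := by
  have h := mk_rel (HCRel.X_Xi i)
  simp only [map_mul, map_one] at h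
  exact h

theorem Xi_X (i : Fin (m + 1)) : Xi i * X i = 1 := by
  have h := mk_rel (HCRel.Xi_X i)
  simp only [map_mul, map_one] at h
  exact h

theorem T_X_T (i : Fin m) :
    (T i + eps • (c i.castSucc * c i.succ)) * X i.castSucc * T i = X i.succ := by
  have h := mk_rel (HCRel.T_X_T i)
  simp only [map_mul, map_add, map_smul] at h
  exact h

theorem T_X_far {i : Fin m} {j : Fin (m + 1)} (h : j ≠ i.castSucc) (h' : j ≠ i.succ) :
    T i * X j = X j * T i := by
  have h := mk_rel (HCRel.T_X_far i j h h')
  simp only [map_mul] at h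
  exact h

theorem X_X (i j : Fin (m + 1)) : Commute (X i) (X j) := by
  have h := mk_rel (HCRel.X_X i j)
  simp only [map_mul] at h
  exact h

theorem X_c (i : Fin (m + 1)) : X i * c i = c i * Xi i := by
  have h := mk_rel (HCRel.X_c i)
  simp only [map_mul] at h
  exact h

theorem X_c_far {i j : Fin (m + 1)} (h : i ≠ j) : Commute (X i) (c j) := by
  have h := mk_rel (HCRel.X_c_far i j h)
  simp only [map_mul] at h
  exact h

/-- Multiply `a X = X a` by `X⁻¹` on both sides. All commutation rules for `X⁻¹` that are missing
from the presentation follow from this. -/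
theorem commute_Xi {a : AffHC m} {i : Fin (m + 1)} (h : Commute a (X i)) : Commute a (Xi i) := by
  have h1 : Xi i * (a * X i) * Xi i = Xi i * (X i * a) * Xi i := by rw [h.eq]
  rw [mul_assoc, mul_assoc, X_Xi, mul_one, ← mul_assoc (Xi i), Xi_X, one_mul] at h1
  exact h1.symm

theorem Xi_c (i : Fin (m + 1)) : Xi i * c i = c i * X i := by
  have h : c i * (X i * c i) * c i = c i * (c i * Xi i) * c i := by rw [X_c]
  rw [mul_assoc, mul_assoc, c_sq, mul_one, ← mul_assoc (c i), c_sq, one_mul] at h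
  exact h.symm

theorem Xi_c_far {i j : Fin (m + 1)} (h : i ≠ j) : Commute (Xi i) (c j) :=
  (commute_Xi (X_c_far h).symm).symm

theorem X_Xi' (i j : Fin (m + 1)) : Commute (X i) (Xi j) := commute_Xi (X_X i j)
theorem Xi_X' (i j : Fin (m + 1)) : Commute (Xi i) (X j) := (X_Xi' j i).symm
theorem Xi_Xi (i j : Fin (m + 1)) : Commute (Xi i) (Xi j) := commute_Xi (Xi_X' i j)

theorem T_Xi_far {i : Fin m} {j : Fin (m + 1)} (h : j ≠ i.castSucc) (h' : j ≠ i.succ) :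
    T i * Xi j = Xi j * T i := commute_Xi (T_X_far h h')

/-- The image of `Rᵢ`. -/
def R (i : Fin m) : AffHC m := spinOfHecke eps (c i.castSucc) (c i.succ) (T i)
/-- The image of `pᵢ`. -/
def p (i : Fin (m + 1)) : AffHC m := pOfX Kq (X i) (Xi i)
/-- The image of `qᵢ`. -/
def q (i : Fin (m + 1)) : AffHC m := qOfX Kq (X i) (Xi i) (c i)

theorem succ_ne (i : Fin m) : i.succ ≠ i.castSucc := i.castSucc_lt_succ.ne'

theorem R_sq (i : Fin m) : R i * R i = (-eps ^ 2 - 2) • (1 : AffHC m) :=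
  spinOfHecke_sq (c_sq _) (c_sq _) (c_c (succ_ne i)) (T_sq i) (T_c i)

theorem R_far {i j : Fin m} (h : (i : ℕ) + 1 < j ∨ (j : ℕ) + 1 < i) :
    R i * R j = -(R j * R i) := by
  refine spinOfHecke_far (c_c ?_) (c_c ?_) (c_c ?_) (c_c ?_) (T_c_far ?_ ?_) (T_c_far ?_ ?_)
    (T_c_far ?_ ?_) (T_c_far ?_ ?_) (far h.symm)
  all_goals intro h'; simp [Fin.ext_iff] at h'; omega

theorem R_braid {i j : Fin m} (h : (j : ℕ) = i + 1) :
    R i * R j * R i - R j * R i * R j = eps ^ 2 • (R j - R i) := by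
  have hj : j.castSucc = i.succ := Fin.ext (by simp [h])
  have h1 : j.succ ≠ i.castSucc := fun h' => by simp [Fin.ext_iff] at h'; omega
  have h2 : j.succ ≠ i.succ := fun h' => by simp [Fin.ext_iff] at h'; omega
  have hb := braid h
  rw [mul_assoc, mul_assoc] at hb
  have hc := T_c j
  rw [hj] at hc
  rw [R, R, hj]
  refine spinOfHecke_braid (c_sq _) (c_sq _) (c_sq _) (c_c (succ_ne i)) (c_c h1)
    (c_c h2) (T_sq i) (T_c i) (T_c_far h1 h2) (T_sq j) hc (T_c_far ?_ h1.symm) hb.symm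
  rw [hj]
  exact (succ_ne i).symm

theorem R_p (i : Fin m) :
    R i * p i.castSucc = p i.succ * R i + eps • (q i.castSucc - q i.succ) :=
  spinOfHecke_mul_p (c_sq _) (c_sq _) (c_c (succ_ne i)) (T_sq i) (T_c i) (T_X_T i) (X_c _) (Xi_c _)
    (X_c_far (succ_ne i)) (Xi_c_far (succ_ne i)) (X_c _) (Xi_c _)

theorem R_q (i : Fin m) :
    R i * q i.castSucc = -(q i.succ * R i) - eps • (p i.castSucc + p i.succ) :=
  spinOfHecke_mul_q (c_sq _) (c_sq _) (c_c (succ_ne i)) (T_sq i) (T_c i) (T_X_T i) (X_c _) (Xi_c _)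
    (X_c_far (succ_ne i)) (Xi_c_far (succ_ne i)) (X_c _) (Xi_c _)

theorem R_p_far {i : Fin m} {j : Fin (m + 1)} (h : j ≠ i.castSucc) (h' : j ≠ i.succ) :
    R i * p j = p j * R i :=
  spinOfHecke_mul_p_far (T_X_far h h') (T_Xi_far h h') (X_c_far h) (Xi_c_far h) (X_c_far h')
    (Xi_c_far h')

theorem R_q_far {i : Fin m} {j : Fin (m + 1)} (h : j ≠ i.castSucc) (h' : j ≠ i.succ) :
    R i * q j = -(q j * R i) :=
  spinOfHecke_mul_q_far (T_X_far h h') (T_Xi_far h h') (T_c_far h h') (c_c h) (c_c h') (X_c_far h)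
    (Xi_c_far h) (X_c_far h') (Xi_c_far h') (X_c _) (Xi_c _)

theorem p_p (i j : Fin (m + 1)) : p i * p j = p j * p i :=
  p_p_of_X (X_X _ _) (X_Xi' _ _) (Xi_X' _ _) (Xi_Xi _ _)

theorem q_q {i j : Fin (m + 1)} (h : i ≠ j) : q i * q j = -(q j * q i) :=
  q_q_of_X (c_c h.symm) (X_X _ _) (X_Xi' _ _) (Xi_X' _ _) (Xi_Xi _ _) (X_c_far h) (Xi_c_far h)
    (X_c_far h.symm) (Xi_c_far h.symm)

theorem circle (i : Fin (m + 1)) : p i * p i + q i * q i = 1 :=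
  circle_of_X (c_sq i) (X_c i) (Xi_c i) (X_Xi i) (Xi_X i)

theorem p_q (i j : Fin (m + 1)) : p i * q j = q j * p i := by
  rcases eq_or_ne i j with rfl | h
  · exact p_q_of_X (X_c i) (Xi_c i) (X_Xi i) (Xi_X i)
  · exact p_q_far_of_X (X_X _ _) (X_Xi' _ _) (Xi_X' _ _) (Xi_Xi _ _) (X_c_far h) (Xi_c_far h)

theorem c_R (j : Fin (m + 1)) (i : Fin m) : c j * R i = -(R i * c j) := by
  rcases eq_or_ne j i.castSucc with rfl | h
  · exact left_mul_spinOfHecke (c_sq _) (c_sq _) (c_c (succ_ne i)) (T_c i)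
  rcases eq_or_ne j i.succ with rfl | h'
  · exact right_mul_spinOfHecke (c_sq _) (c_sq _) (c_c (succ_ne i)) (T_sq i) (T_c i)
  · exact far_mul_spinOfHecke (c_c h) (c_c h') (T_c_far h h')

theorem c_p (j i : Fin (m + 1)) : c j * p i = p i * c j := by
  unfold p pOfX
  rcases eq_or_ne i j with rfl | h
  · rw [mul_smul_comm, smul_mul_assoc, mul_add, add_mul, X_c, Xi_c, add_comm]
  · exact (((X_c_far h).add_left (Xi_c_far h)).smul_left _).eq.symm

theorem c_q (j i : Fin (m + 1)) : c j * q i = -(q i * c j) := by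
  unfold q qOfX
  rw [mul_smul_comm, smul_mul_assoc, ← smul_neg]
  congr 1
  rcases eq_or_ne i j with rfl | h
  · rw [sub_mul, X_c, Xi_c, ← mul_sub, ← mul_assoc, c_sq, one_mul, mul_assoc, sub_mul, Xi_c, X_c,
      ← mul_sub, ← mul_assoc, c_sq, one_mul, neg_sub]
  · rw [mul_assoc, c_c h, mul_neg, neg_neg, ← mul_assoc, ← mul_assoc,
      ((X_c_far h).sub_left (Xi_c_far h)).eq]

theorem parity_mk (x : FreeAlgebra Kq (HCGen m)) :
    parity m (mk m x) = FreeAlgebra.lift Kq (parityGen (m := m)) x :=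
  RingQuot.liftAlgHom_mkAlgHom_apply Kq _ _ x

theorem parity_T (i : Fin m) : parity m (T i) = T i := by
  rw [T, parity_mk, FreeAlgebra.lift_ι_apply]; rfl
theorem parity_c (i : Fin (m + 1)) : parity m (c i) = -c i := by
  rw [c, parity_mk, FreeAlgebra.lift_ι_apply]; rfl
theorem parity_X (i : Fin (m + 1)) : parity m (X i) = X i := by
  rw [X, parity_mk, FreeAlgebra.lift_ι_apply]; rfl
theorem parity_Xi (i : Fin (m + 1)) : parity m (Xi i) = Xi i := by
  rw [Xi, parity_mk, FreeAlgebra.lift_ι_apply]; rfl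

theorem parity_R (i : Fin m) : parity m (R i) = -R i := by
  rw [R, spinOfHecke, map_add, map_mul, map_sub, map_smul, parity_c, parity_c, parity_T, smul_neg,
    neg_add, ← neg_mul]
  congr 2
  abel
theorem parity_p (i : Fin (m + 1)) : parity m (p i) = p i := by
  rw [p, pOfX, map_smul, map_add, parity_X, parity_Xi]
theorem parity_q (i : Fin (m + 1)) : parity m (q i) = -q i := by
  rw [q, qOfX, map_smul, map_mul, map_sub, parity_X, parity_Xi, parity_c, mul_neg, smul_neg]

theorem algHom_ext {B : Type*} [Ring B] [Algebra Kq B] {f g : AffHC m →ₐ[Kq] B}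
    (hT : ∀ i, f (T i) = g (T i)) (hc : ∀ i, f (c i) = g (c i)) (hX : ∀ i, f (X i) = g (X i))
    (hXi : ∀ i, f (Xi i) = g (Xi i)) : f = g := by
  refine RingQuot.ringQuot_ext' Kq _ _ (FreeAlgebra.hom_ext (funext fun x => ?_))
  cases x with
  | T i => exact hT i
  | c i => exact hc i
  | X i => exact hX i
  | Xi i => exact hXi i

end AffHC

theorem AffSpin.algHom_ext {B : Type*} [Ring B] [Algebra Kq B] {f g : AffSpin m →ₐ[Kq] B}
    (hR : ∀ i, f (R i) = g (R i)) (hp : ∀ i, f (p i) = g (p i)) (hq : ∀ i, f (q i) = g (q i)) :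
    f = g := by
  refine RingQuot.ringQuot_ext' Kq _ _ (FreeAlgebra.hom_ext (funext fun x => ?_))
  cases x with
  | R i => exact hR i
  | p i => exact hp i
  | q i => exact hq i

theorem AffSpin.induction {P : AffSpin m → Prop} (halg : ∀ r, P (algebraMap Kq _ r))
    (hR : ∀ i, P (R i)) (hp : ∀ i, P (p i)) (hq : ∀ i, P (q i))
    (hmul : ∀ a b, P a → P b → P (a * b)) (hadd : ∀ a b, P a → P b → P (a + b)) (a : AffSpin m) :
    P a := by
  obtain ⟨x, rfl⟩ : ∃ x, mk m x = a := RingQuot.mkAlgHom_surjective Kq _ a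
  induction x using FreeAlgebra.induction with
  | grade0 r => rw [AlgHom.commutes]; exact halg r
  | grade1 x =>
    cases x with
    | R i => exact hR i
    | p i => exact hp i
    | q i => exact hq i
  | mul a b ha hb => rw [map_mul]; exact hmul _ _ ha hb
  | add a b ha hb => rw [map_add]; exact hadd _ _ ha hb

/-! ### The homomorphism `Ψ` -/

/-- The values of `Ψ` on the free generators of the spin affine Hecke algebra. -/
def psiGen : SpinGen m → AffHC m
  | .R i => AffHC.R i
  | .p i => AffHC.p i
  | .q i => AffHC.q i

theorem psi_rel ⦃a b : FreeAlgebra Kq (SpinGen m)⦄ (h : SpinRel m a b) :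
    FreeAlgebra.lift Kq (psiGen (m := m)) a = FreeAlgebra.lift Kq (psiGen (m := m)) b := by
  induction h with
  | R_sq i =>
    rw [map_mul, FreeAlgebra.lift_ι_apply, AlgHom.commutes, Algebra.algebraMap_eq_smul_one]
    exact AffHC.R_sq i
  | R_far i j h => simpa [psiGen] using AffHC.R_far h
  | braid i j h => simpa [psiGen] using AffHC.R_braid h
  | p_p i j => simpa [psiGen] using AffHC.p_p i j
  | q_q i j h => simpa [psiGen] using AffHC.q_q h
  | circle i => simpa [psiGen] using AffHC.circle i
  | p_q i j => simpa [psiGen] using AffHC.p_q i j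
  | R_p_far i j h h' => simpa [psiGen] using AffHC.R_p_far h h'
  | R_q_far i j h h' => simpa [psiGen] using AffHC.R_q_far h h'
  | R_p i => simpa [psiGen] using AffHC.R_p i
  | R_q i => simpa [psiGen] using AffHC.R_q i

/-- The restriction of `Ψ` to the spin affine Hecke algebra. -/
def psiS (m : ℕ) : AffSpin m →ₐ[Kq] AffHC m :=
  RingQuot.liftAlgHom Kq ⟨FreeAlgebra.lift Kq (psiGen (m := m)), psi_rel⟩

theorem psiS_mk (x : FreeAlgebra Kq (SpinGen m)) :
    psiS m (AffSpin.mk m x) = FreeAlgebra.lift Kq (psiGen (m := m)) x :=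
  RingQuot.liftAlgHom_mkAlgHom_apply Kq _ _ x

theorem psiS_R (i : Fin m) : psiS m (AffSpin.R i) = AffHC.R i := by
  rw [AffSpin.R, psiS_mk, FreeAlgebra.lift_ι_apply]; rfl
theorem psiS_p (i : Fin (m + 1)) : psiS m (AffSpin.p i) = AffHC.p i := by
  rw [AffSpin.p, psiS_mk, FreeAlgebra.lift_ι_apply]; rfl
theorem psiS_q (i : Fin (m + 1)) : psiS m (AffSpin.q i) = AffHC.q i := by
  rw [AffSpin.q, psiS_mk, FreeAlgebra.lift_ι_apply]; rfl

theorem cliffForm_apply (v : Fin (m + 1) → Kq) : cliffForm m v = ∑ i, v i * v i := by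
  simp [cliffForm, QuadraticMap.weightedSumSquares_apply]

/-- Twice the square is the sum of `vᵢ vⱼ (cᵢcⱼ + cⱼcᵢ)`, in which only the diagonal survives; then
2 is cancelled. This is the condition for extending `cᵢ ↦ cᵢ` to the Clifford algebra. -/
theorem sum_smul_c_sq (v : Fin (m + 1) → Kq) :
    (∑ i, v i • AffHC.c i) * (∑ i, v i • AffHC.c i) =
      algebraMap Kq (AffHC m) (cliffForm m v) := by
  have h : ∀ i j : Fin (m + 1), AffHC.c i * AffHC.c j + AffHC.c j * AffHC.c i =
      if i = j then (2 : Kq) • (1 : AffHC m) else 0 := by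
    intro i j
    split_ifs with hij
    · subst hij; rw [AffHC.c_sq, two_smul]
    · rw [AffHC.c_c hij, neg_add_cancel]
  have e1 : (∑ i, v i • AffHC.c i) * (∑ i, v i • AffHC.c i) =
      ∑ i, ∑ j, (v i * v j) • (AffHC.c i * AffHC.c j : AffHC m) := by
    rw [Finset.sum_mul_sum]
    simp only [smul_mul_smul_comm]
  have e2 : ∑ i, ∑ j, (v i * v j) • (AffHC.c i * AffHC.c j : AffHC m) =
      ∑ i, ∑ j, (v i * v j) • (AffHC.c j * AffHC.c i : AffHC m) := by
    rw [Finset.sum_comm]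
    simp only [mul_comm]
  have e3 : (2 : Kq) • ((∑ i, v i • AffHC.c i) * (∑ i, v i • AffHC.c i)) =
      (2 : Kq) • algebraMap Kq (AffHC m) (cliffForm m v) := by
    rw [two_smul]
    conv_lhs => rw [e1]; rhs; rw [e2]
    simp only [← Finset.sum_add_distrib, ← smul_add, h, smul_ite, smul_zero, Finset.sum_ite_eq,
      Finset.mem_univ, if_true]
    rw [cliffForm_apply, Algebra.algebraMap_eq_smul_one, Finset.sum_smul, Finset.smul_sum]
    exact Finset.sum_congr rfl fun i _ => smul_comm _ _ _
  exact smul_right_injective _ two_ne_zero e3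

/-- The restriction of `Ψ` to the Clifford algebra. -/
def psiC (m : ℕ) : Cliff m →ₐ[Kq] AffHC m :=
  CliffordAlgebra.lift (cliffForm m) ⟨Fintype.linearCombination Kq AffHC.c, fun v => by
    rw [Fintype.linearCombination_apply, sum_smul_c_sq]⟩

theorem psiC_ι (v : Fin (m + 1) → Kq) :
    psiC m (CliffordAlgebra.ι (cliffForm m) v) = ∑ i, v i • AffHC.c i := by
  rw [psiC, CliffordAlgebra.lift_ι_apply, Fintype.linearCombination_apply]

theorem psiC_c (i : Fin (m + 1)) : psiC m (cliffC i) = AffHC.c i := by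
  rw [cliffC, psiC_ι, Finset.sum_eq_single i]
  · simp
  · intro j _ hj; simp [Pi.single_eq_of_ne hj]
  · simp

/-- Both sides are multiplicative in `b`, so it suffices that the images of `pᵢ` commute, and those
of `qᵢ`, `Rᵢ` anticommute, with the Clifford generators. Expressing the sign by the parity
automorphism avoids any homogeneity assumption in the induction. -/
theorem c_mul_psiS (i : Fin (m + 1)) (b : AffSpin m) :
    AffHC.c i * psiS m b = psiS m (AffSpin.parity m b) * AffHC.c i := by
  induction b using AffSpin.induction with
  | halg r => simp only [AlgHom.commutes, Algebra.commutes]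
  | hR j => rw [AffSpin.parity_R, map_neg, psiS_R, AffHC.c_R, neg_mul]
  | hp j => rw [AffSpin.parity_p, psiS_p, AffHC.c_p]
  | hq j => rw [AffSpin.parity_q, map_neg, psiS_q, AffHC.c_q, neg_mul]
  | hmul a b ha hb => rw [map_mul, map_mul, map_mul, ← mul_assoc, ha, mul_assoc, hb, mul_assoc]
  | hadd a b ha hb => rw [map_add, map_add, map_add, mul_add, add_mul, ha, hb]

theorem involute_of_mem {i : ZMod 2} {a : Cliff m} (ha : a ∈ cliffGr m i) :
    CliffordAlgebra.involute a = sgn Kq i • a := by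
  rcases zcases i with rfl | rfl
  · simpa using CliffordAlgebra.involute_eq_of_mem_even ha
  · simpa using CliffordAlgebra.involute_eq_of_mem_odd ha

theorem psiC_mul_psiS_even (a : Cliff m) {b : AffSpin m} (hb : AffSpin.parity m b = b) :
    psiC m a * psiS m b = psiS m b * psiC m a := by
  induction a using CliffordAlgebra.induction with
  | algebraMap r => simp only [AlgHom.commutes, Algebra.commutes]
  | ι v =>
    rw [psiC_ι, Finset.sum_mul, Finset.mul_sum]
    refine Finset.sum_congr rfl fun i _ => ?_
    rw [smul_mul_assoc, c_mul_psiS, hb, mul_smul_comm]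
  | mul x y hx hy => rw [map_mul, mul_assoc, hy, ← mul_assoc, hx, mul_assoc]
  | add x y hx hy => rw [map_add, mul_add, add_mul, hx, hy]

theorem psiC_mul_psiS_odd (a : Cliff m) {b : AffSpin m} (hb : AffSpin.parity m b = -b) :
    psiC m a * psiS m b = psiS m b * psiC m (CliffordAlgebra.involute a) := by
  induction a using CliffordAlgebra.induction with
  | algebraMap r => simp only [AlgHom.commutes, Algebra.commutes]
  | ι v =>
    rw [CliffordAlgebra.involute_ι, map_neg, psiC_ι, Finset.sum_mul, mul_neg, Finset.mul_sum,
      ← Finset.sum_neg_distrib]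
    refine Finset.sum_congr rfl fun i _ => ?_
    rw [smul_mul_assoc, c_mul_psiS, hb, map_neg, mul_smul_comm, neg_mul, smul_neg]
  | mul x y hx hy => rw [map_mul, map_mul, map_mul, mul_assoc, hy, ← mul_assoc, hx, mul_assoc]
  | add x y hx hy => rw [map_add, map_add, map_add, mul_add, add_mul, hx, hy]

/-- The hypothesis of the universal property of the graded tensor product. For even `b` the images
commute; for odd `b`, passing across `a` applies the Clifford involution, which is a sign on
homogeneous `a`. -/
theorem psi_anticomm ⦃i j : ZMod 2⦄ (a : cliffGr m i) (b : AffSpin.gr m j) :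
    psiC m a * psiS m b = ((-1 : ℤˣ) ^ (j * i)) • (psiS m b * psiC m a) := by
  have hb := mem_superGr.1 b.2
  rw [zpow_sgn_smul]
  rcases zcases j with rfl | rfl
  · rw [zero_mul, sgn_zero, one_smul]
    exact psiC_mul_psiS_even _ (by simpa using hb)
  · rw [one_mul, psiC_mul_psiS_odd _ (by simpa using hb), involute_of_mem a.2, map_smul,
      mul_smul_comm]

/-- The homomorphism `Ψ`. -/
def psi (m : ℕ) : CliffSpin m →ₐ[Kq] AffHC m :=
  GradedTensorProduct.lift (cliffGr m) (AffSpin.gr m) (psiC m) (psiS m) psi_anticomm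

theorem psi_inC (a : Cliff m) : psi m (inC a) = psiC m a := by
  change psi m (a ᵍ⊗ₜ[Kq] 1) = _
  rw [psi, GradedTensorProduct.lift_tmul, map_one, mul_one]

theorem psi_inS (b : AffSpin m) : psi m (inS b) = psiS m b := by
  change psi m (1 ᵍ⊗ₜ[Kq] b) = _
  rw [psi, GradedTensorProduct.lift_tmul, map_one, one_mul]

theorem psi_c (i : Fin (m + 1)) : psi m (CliffSpin.c i) = AffHC.c i := by
  rw [CliffSpin.c, psi_inC, psiC_c]
theorem psi_R (i : Fin m) : psi m (CliffSpin.R i) = AffHC.R i := by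
  rw [CliffSpin.R, psi_inS, psiS_R]
theorem psi_p (i : Fin (m + 1)) : psi m (CliffSpin.p i) = AffHC.p i := by
  rw [CliffSpin.p, psi_inS, psiS_p]
theorem psi_q (i : Fin (m + 1)) : psi m (CliffSpin.q i) = AffHC.q i := by
  rw [CliffSpin.q, psi_inS, psiS_q]

theorem map_heckeOfSpin {A B : Type*} [Ring A] [Algebra Kq A] [Ring B] [Algebra Kq B]
    (f : A →ₐ[Kq] B) (e : Kq) (c d R : A) :
    f (heckeOfSpin e c d R) = heckeOfSpin e (f c) (f d) (f R) := by
  simp only [heckeOfSpin, map_add, map_smul, map_mul, map_sub, map_one]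

theorem map_spinOfHecke {A B : Type*} [Ring A] [Algebra Kq A] [Ring B] [Algebra Kq B]
    (f : A →ₐ[Kq] B) (e : Kq) (c d T : A) :
    f (spinOfHecke e c d T) = spinOfHecke e (f c) (f d) (f T) := by
  simp only [spinOfHecke, map_add, map_smul, map_mul, map_sub]

theorem psi_comp_phi : (psi m).comp (phi m) = AlgHom.id Kq (AffHC m) := by
  refine AffHC.algHom_ext (fun i => ?_) (fun i => ?_) (fun i => ?_) (fun i => ?_)
  · rw [AlgHom.comp_apply, phi_T, CliffSpin.T, map_heckeOfSpin, psi_c, psi_c, psi_R]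
    exact heckeOfSpin_spinOfHecke (AffHC.c_sq _) (AffHC.c_sq _) (AffHC.c_c (AffHC.succ_ne i))
      (AffHC.T_sq i) (AffHC.T_c i)
  · rw [AlgHom.comp_apply, phi_c, psi_c]; rfl
  · rw [AlgHom.comp_apply, phi_X, CliffSpin.X, map_sub, map_mul, psi_p, psi_c, psi_q]
    exact pOfX_sub (AffHC.c_sq i) (AffHC.X_c i) (AffHC.Xi_c i)
  · rw [AlgHom.comp_apply, phi_Xi, CliffSpin.Xi, map_add, map_mul, psi_p, psi_c, psi_q]
    exact pOfX_add (AffHC.c_sq i) (AffHC.X_c i) (AffHC.Xi_c i)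

theorem phi_psiC (a : Cliff m) : phi m (psiC m a) = inC a := by
  have h : (phi m).comp (psiC m) = inC := by
    refine CliffordAlgebra.hom_ext (LinearMap.ext fun v => ?_)
    change phi m (psiC m (CliffordAlgebra.ι (cliffForm m) v)) =
      inC (CliffordAlgebra.ι (cliffForm m) v)
    rw [psiC_ι, ι_eq_sum_cliffC, map_sum, map_sum]
    refine Finset.sum_congr rfl fun i _ => ?_
    rw [map_smul, map_smul, phi_c]; rfl
  exact DFunLike.congr_fun h a

theorem phi_psiS (b : AffSpin m) : phi m (psiS m b) = inS b := by
  have h : (phi m).comp (psiS m) = inS := by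
    refine AffSpin.algHom_ext (fun i => ?_) (fun i => ?_) (fun i => ?_)
    · rw [AlgHom.comp_apply, psiS_R, AffHC.R, map_spinOfHecke, phi_c, phi_c, phi_T]
      exact spinOfHecke_heckeOfSpin (CliffSpin.c_sq _) (CliffSpin.c_sq _)
        (CliffSpin.c_c (CliffSpin.succ_ne i)) (CliffSpin.c_R _ _) (CliffSpin.c_R _ _)
    · rw [AlgHom.comp_apply, psiS_p, AffHC.p, pOfX, map_smul, map_add, phi_X, phi_Xi]
      exact pOfX_eq
    · rw [AlgHom.comp_apply, psiS_q, AffHC.q, qOfX, map_smul, map_mul, map_sub, phi_X, phi_Xi,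
        phi_c]
      exact qOfX_eq (CliffSpin.c_sq i) (CliffSpin.c_q i i)
  exact DFunLike.congr_fun h b

theorem phi_comp_psi : (phi m).comp (psi m) = AlgHom.id Kq (CliffSpin m) := by
  refine GradedTensorProduct.algHom_ext _ _ (AlgHom.ext fun a => ?_) (AlgHom.ext fun b => ?_)
  · change phi m (psi m (inC a)) = inC a
    rw [psi_inC, phi_psiC]
  · change phi m (psi m (inS b)) = inS b
    rw [psi_inS, phi_psiS]

/-- The isomorphism `Φ`. -/
def phiEquiv (m : ℕ) : AffHC m ≃ₐ[Kq] CliffSpin m :=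
  AlgEquiv.ofAlgHom (phi m) (psi m) phi_comp_psi psi_comp_phi

theorem phiEquiv_apply (x : AffHC m) : phiEquiv m x = phi m x := rfl

theorem isPhi : IsPhi (phiEquiv m) where
  c := phi_c
  T i := by
    rw [phiEquiv_apply, phi_T, map_sub, map_mul]; rfl
  X := phi_X
  Xi := phi_Xi

theorem isPsi : IsPsi (phiEquiv m).symm where
  c := psi_c
  R := psi_R
  p := psi_p
  q := psi_q

/-! ### The gradings -/

/-- Split `f a` into its two components. The component of the wrong degree pulls back to an
eigenvector of `σ` for the wrong sign, so twice it vanishes. Only the spanning of `B` by `ℬ 0` and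
`ℬ 1` is needed, not that their sum is direct, which suits gradings defined as spans. -/
theorem isSuper_of_symm {A B : Type*} [Ring A] [Algebra Kq A] [Ring B] [Algebra Kq B]
    {σ : A →ₐ[Kq] A} {ℬ : ZMod 2 → Submodule Kq B} {f : A ≃ₐ[Kq] B}
    (h : ∀ i, ∀ b ∈ ℬ i, f.symm b ∈ superGr σ i) (htop : ∀ b, ∃ x ∈ ℬ 0, ∃ y ∈ ℬ 1, b = x + y) :
    IsSuper (superGr σ) ℬ f := by
  intro i
  ext b
  constructor
  · rintro ⟨a, ha, rfl⟩
    obtain ⟨x, hx, y, hy, e⟩ := htop (f a)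
    have e' : a = f.symm x + f.symm y := by
      rw [← map_add, ← e, AlgEquiv.symm_apply_apply]
    have hx' := mem_superGr.1 (h 0 x hx)
    have hy' := mem_superGr.1 (h 1 y hy)
    have ha' := mem_superGr.1 ha
    rw [e', map_add, hx', hy'] at ha'
    change f a ∈ ℬ i
    rcases zcases i with rfl | rfl
    · rw [sgn_zero, sgn_one] at ha'
      have : (2 : Kq) • f.symm y = 0 := by
        rw [one_smul, one_smul, neg_one_smul, add_right_inj] at ha'
        rw [two_smul]; nth_rewrite 1 [← ha']; exact neg_add_cancel _
      rw [smul_eq_zero_iff_right two_ne_zero, map_eq_zero_iff _ f.symm.injective] at this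
      rw [e, this, add_zero]; exact hx
    · rw [sgn_zero, sgn_one] at ha'
      have : (2 : Kq) • f.symm x = 0 := by
        rw [one_smul, smul_add, add_left_inj, neg_one_smul] at ha'
        rw [two_smul]; nth_rewrite 1 [ha']; exact neg_add_cancel _
      rw [smul_eq_zero_iff_right two_ne_zero, map_eq_zero_iff _ f.symm.injective] at this
      rw [e, this, zero_add]; exact hy
  · intro hb
    exact ⟨f.symm b, h i b hb, f.apply_symm_apply b⟩

theorem eq_decompose_add {F A : Type*} [Field F] [Ring A] [Algebra F A]
    (𝒜 : ZMod 2 → Submodule F A) [GradedAlgebra 𝒜] (a : A) :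
    a = DirectSum.decompose 𝒜 a 0 + DirectSum.decompose 𝒜 a 1 := by
  have h := congrArg (DirectSum.decompose 𝒜).symm (DirectSum.sum_univ_of (DirectSum.decompose 𝒜 a))
  rw [(DirectSum.decompose 𝒜).symm_apply_apply, DirectSum.decompose_symm_sum,
    show (Finset.univ : Finset (ZMod 2)) = {0, 1} from rfl, Finset.sum_pair (by decide),
    DirectSum.decompose_symm_of, DirectSum.decompose_symm_of] at h
  exact h.symm

theorem exists_add_of_graded {A : Type*} [Ring A] [Algebra Kq A] (𝒜 : ZMod 2 → Submodule Kq A)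
    [GradedAlgebra 𝒜] (a : A) : ∃ x ∈ 𝒜 0, ∃ y ∈ 𝒜 1, a = x + y :=
  ⟨_, SetLike.coe_mem (DirectSum.decompose 𝒜 a 0), _,
    SetLike.coe_mem (DirectSum.decompose 𝒜 a 1), eq_decompose_add 𝒜 a⟩

theorem exists_add_of_tensor (b : CliffSpin m) :
    ∃ x ∈ tensorGr (cliffGr m) (AffSpin.gr m) 0, ∃ y ∈ tensorGr (cliffGr m) (AffSpin.gr m) 1,
      b = x + y := by
  induction b using TensorProduct.induction_on with
  | zero => exact ⟨0, zero_mem _, 0, zero_mem _, (add_zero _).symm⟩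
  | add a b ha hb =>
    obtain ⟨x, hx, y, hy, rfl⟩ := ha
    obtain ⟨x', hx', y', hy', rfl⟩ := hb
    exact ⟨x + x', add_mem hx hx', y + y', add_mem hy hy', add_add_add_comm _ _ _ _⟩
  | tmul a b =>
    obtain ⟨a0, ha0, a1, ha1, rfl⟩ := exists_add_of_graded (cliffGr m) a
    obtain ⟨b0, hb0, b1, hb1, rfl⟩ := exists_add_of_graded (AffSpin.gr m) b
    refine ⟨a0 ᵍ⊗ₜ[Kq] b0 + a1 ᵍ⊗ₜ[Kq] b1, add_mem ?_ ?_, a0 ᵍ⊗ₜ[Kq] b1 + a1 ᵍ⊗ₜ[Kq] b0,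
      add_mem ?_ ?_, ?_⟩
    · exact Submodule.subset_span ⟨0, 0, rfl, a0, ha0, b0, hb0, rfl⟩
    · exact Submodule.subset_span ⟨1, 1, rfl, a1, ha1, b1, hb1, rfl⟩
    · exact Submodule.subset_span ⟨0, 1, rfl, a0, ha0, b1, hb1, rfl⟩
    · exact Submodule.subset_span ⟨1, 0, rfl, a1, ha1, b0, hb0, rfl⟩
    · change ((a0 + a1) ᵍ⊗ₜ[Kq] (b0 + b1) : CliffSpin m) = _
      simp only [tmul_eq, map_add, mul_add, add_mul]
      abel

theorem superGr_mul {A : Type*} [Ring A] [Algebra Kq A] {σ : A →ₐ[Kq] A} {i j : ZMod 2} {a b : A}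
    (ha : a ∈ superGr σ i) (hb : b ∈ superGr σ j) : a * b ∈ superGr σ (i + j) := by
  rw [mem_superGr] at *
  rw [map_mul, ha, hb, smul_mul_smul_comm, sgn_add]

theorem parity_psiC (a : Cliff m) :
    AffHC.parity m (psiC m a) = psiC m (CliffordAlgebra.involute a) := by
  have h : (AffHC.parity m).comp (psiC m) = (psiC m).comp CliffordAlgebra.involute := by
    refine CliffordAlgebra.hom_ext (LinearMap.ext fun v => ?_)
    change AffHC.parity m (psiC m (CliffordAlgebra.ι (cliffForm m) v)) =
      psiC m (CliffordAlgebra.involute (CliffordAlgebra.ι (cliffForm m) v))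
    rw [CliffordAlgebra.involute_ι, map_neg, psiC_ι, map_sum, ← Finset.sum_neg_distrib]
    refine Finset.sum_congr rfl fun i _ => ?_
    rw [map_smul, AffHC.parity_c, smul_neg]
  exact DFunLike.congr_fun h a

theorem parity_psiS (b : AffSpin m) :
    AffHC.parity m (psiS m b) = psiS m (AffSpin.parity m b) := by
  have h : (AffHC.parity m).comp (psiS m) = (psiS m).comp (AffSpin.parity m) := by
    refine AffSpin.algHom_ext (fun i => ?_) (fun i => ?_) (fun i => ?_)
    · rw [AlgHom.comp_apply, AlgHom.comp_apply, psiS_R, AffHC.parity_R, AffSpin.parity_R, map_neg,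
        psiS_R]
    · rw [AlgHom.comp_apply, AlgHom.comp_apply, psiS_p, AffHC.parity_p, AffSpin.parity_p, psiS_p]
    · rw [AlgHom.comp_apply, AlgHom.comp_apply, psiS_q, AffHC.parity_q, AffSpin.parity_q, map_neg,
        psiS_q]
  exact DFunLike.congr_fun h b

theorem isSuper_phiEquiv :
    IsSuper (AffHC.gr m) (tensorGr (cliffGr m) (AffSpin.gr m)) (phiEquiv m) := by
  refine isSuper_of_symm (fun i b hb => ?_) exists_add_of_tensor
  refine (Submodule.span_le (p := (AffHC.gr m i).comap (phiEquiv m).symm.toLinearMap)).2 ?_ hb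
  rintro _ ⟨j, l, rfl, a, ha, b, hb, rfl⟩
  change psi m (a ᵍ⊗ₜ[Kq] b) ∈ AffHC.gr m (j + l)
  rw [tmul_eq, map_mul, psi_inC, psi_inS]
  refine superGr_mul ?_ ?_
  · rw [mem_superGr, parity_psiC, involute_of_mem ha, map_smul]
  · rw [mem_superGr, parity_psiS, mem_superGr.1 hb, map_smul]

end Maps

/-! ### Comparison of `𝒜₁` with Laurent polynomials under `X ↦ X⁻¹`. -/

section Laurent
open LaurentPolynomial
open Polynomial (toLaurent)

variable (k : Type*) [Field k] [CharZero k]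

/-- The Laurent polynomial `(X + X⁻¹) / 2`. -/
def lP : k[T;T⁻¹] := C 2⁻¹ * (T 1 + T (-1))

/-- The Laurent polynomial `(X - X⁻¹) / 2`. -/
def lD : k[T;T⁻¹] := C 2⁻¹ * (T 1 - T (-1))

theorem two_mul_C_half : (2 : k[T;T⁻¹]) * C 2⁻¹ = 1 := by
  have h : (2 : k[T;T⁻¹]) = C 2 := (map_ofNat C 2).symm
  rw [h, ← map_mul, mul_inv_cancel₀ two_ne_zero, map_one]

theorem T_mul_T_neg : (T 1 * T (-1) : k[T;T⁻¹]) = 1 := by rw [← T_add]; simp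

theorem lP_add_lD : lP k + lD k = T 1 := by
  unfold lP lD
  linear_combination T 1 * two_mul_C_half k

theorem lP_sub_lD : lP k - lD k = T (-1) := by
  unfold lP lD
  linear_combination T (-1) * two_mul_C_half k

theorem lD_mul_lD : lD k * lD k = lP k * lP k - 1 := by
  have h := T_mul_T_neg k
  rw [← lP_add_lD, ← lP_sub_lD] at h
  linear_combination -h

theorem invert_lP : invert (lP k) = lP k := by
  simp [lP, add_comm]

theorem invert_lD : invert (lD k) = -lD k := by
  simp only [lD, map_mul, map_sub, invert_C, invert_T, neg_neg]
  ring

theorem lD_ne_zero : lD k ≠ 0 := by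
  intro h
  have h1 := lP_add_lD k
  have h2 := lP_sub_lD k
  rw [h, add_zero] at h1
  rw [h, sub_zero, h1] at h2
  have := congrArg (fun f => f.coeff 1) h2
  simp at this

/-- Substitution of `(X + X⁻¹) / 2` into a polynomial. -/
def evL : Polynomial k →ₐ[k] k[T;T⁻¹] := Polynomial.aeval (lP k)

theorem evL_X : evL k .X = lP k := Polynomial.aeval_X _

theorem invert_evL (f : Polynomial k) : invert (evL k f) = evL k f := by
  rw [evL, ← AlgEquiv.coe_toAlgHom, ← Polynomial.aeval_algHom_apply]
  simp [invert_lP]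

theorem aeval_T_one (f : Polynomial k) : Polynomial.aeval (T 1 : k[T;T⁻¹]) f = toLaurent f := by
  have h : (Polynomial.aeval (T 1 : k[T;T⁻¹])) = (Polynomial.toLaurentAlg (R := k)) := by
    ext1
    simp
  rw [h]; rfl

/-- If `P` were algebraic, hence integral, over `k`, then `X`, a root of `Y² - 2PY + 1`, would be
integral over `k` too, contradicting its transcendence. -/
theorem evL_injective : Function.Injective (evL k) := by
  rw [injective_iff_map_eq_zero]
  intro f hf
  by_contra hne
  have hP : IsIntegral k (lP k) := IsAlgebraic.isIntegral ⟨f, hne, hf⟩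
  have hT : IsIntegral (integralClosure k k[T;T⁻¹]) (T 1 : k[T;T⁻¹]) := by
    refine ⟨.X ^ 2 - .C (2 * ⟨lP k, hP⟩) * .X + 1, ?_, ?_⟩
    · monicity!
    · simp only [Polynomial.eval₂_add, Polynomial.eval₂_sub, Polynomial.eval₂_mul,
        Polynomial.eval₂_pow, Polynomial.eval₂_X, Polynomial.eval₂_C, Polynomial.eval₂_one, map_mul]
      change T 1 ^ 2 - algebraMap _ k[T;T⁻¹] 2 * lP k * T 1 + 1 = 0
      rw [map_ofNat]
      have h1 := T_mul_T_neg k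
      have h2 := lP_add_lD k
      have h3 := lP_sub_lD k
      linear_combination -h1 - T 1 * h2 - T 1 * h3
  obtain ⟨g, hg, hg0⟩ := isIntegral_trans (R := k) _ hT
  rw [← Polynomial.aeval_def, aeval_T_one, Polynomial.toLaurent_eq_zero] at hg0
  exact hg.ne_zero hg0

/-- Because `D² = P² - 1`, these elements are closed under products, and they contain the constants,
`X = P + D` and `X⁻¹ = P - D`. -/
theorem exists_eq_evL_add (x : k[T;T⁻¹]) : ∃ f g, x = evL k f + evL k g * lD k := by
  have hadd : ∀ x y : k[T;T⁻¹], (∃ f g, x = evL k f + evL k g * lD k) →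
      (∃ f g, y = evL k f + evL k g * lD k) → ∃ f g, x + y = evL k f + evL k g * lD k := by
    rintro _ _ ⟨f, g, rfl⟩ ⟨f', g', rfl⟩
    refine ⟨f + f', g + g', ?_⟩
    rw [map_add, map_add]; ring
  have hmul : ∀ x y : k[T;T⁻¹], (∃ f g, x = evL k f + evL k g * lD k) →
      (∃ f g, y = evL k f + evL k g * lD k) → ∃ f g, x * y = evL k f + evL k g * lD k := by
    rintro _ _ ⟨f, g, rfl⟩ ⟨f', g', rfl⟩
    refine ⟨f * f' + g * g' * (.X * .X - 1), f * g' + g * f', ?_⟩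
    simp only [map_add, map_mul, map_sub, map_one, evL_X]
    linear_combination evL k g * evL k g' * lD_mul_lD k
  have h1 : ∃ f g, (T 1 : k[T;T⁻¹]) = evL k f + evL k g * lD k :=
    ⟨.X, 1, by rw [evL_X, map_one, one_mul, lP_add_lD]⟩
  have h2 : ∃ f g, (T (-1) : k[T;T⁻¹]) = evL k f + evL k g * lD k :=
    ⟨.X, -1, by rw [evL_X, map_neg, map_one, ← lP_sub_lD]; ring⟩
  induction x using LaurentPolynomial.induction_on with
  | h_C a => exact ⟨.C a, 0, by rw [evL, Polynomial.aeval_C, map_zero, zero_mul, add_zero]; rfl⟩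
  | h_add hx hy => exact hadd _ _ hx hy
  | h_C_mul_T n a h => rw [T_add, ← mul_assoc]; exact hmul _ _ h h1
  | h_C_mul_T_Z n a h => rw [T_sub, ← mul_assoc]; exact hmul _ _ h h2

/-- Inversion fixes `P` and negates `D`, so the two summands vanish separately; then `D` is
cancelled in a domain. -/
theorem evL_add_eq_zero {f g : Polynomial k} (h : evL k f + evL k g * lD k = 0) :
    f = 0 ∧ g = 0 := by
  have h' := congrArg invert h
  rw [map_add, map_mul, invert_evL, invert_evL, invert_lD, map_zero] at h'
  have e1 : evL k f = 0 := by
    linear_combination C 2⁻¹ * h + C 2⁻¹ * h' - evL k f * two_mul_C_half k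
  rw [e1, zero_add] at h
  have e2 := (mul_eq_zero.1 h).resolve_right (lD_ne_zero k)
  exact ⟨evL_injective k (e1.trans (map_zero _).symm), evL_injective k (e2.trans (map_zero _).symm)⟩

/-! ### The algebra `𝒜₁` and Laurent polynomials -/

namespace A1

/-- The element `q₁` of `𝒜₁`. -/
def qA : A1 k := mk k .X

/-- The inclusion `k[p₁] → 𝒜₁`. -/
def ev : Polynomial k →ₐ[k] A1 k := (mk k).comp Polynomial.CAlgHom

theorem qA_mul_qA : qA k * qA k = 1 - ev k .X * ev k .X := by
  have h : mk k (.C .X ^ 2 + .X ^ 2 - 1) = 0 :=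
    Ideal.Quotient.eq_zero_iff_mem.2 (Ideal.subset_span rfl)
  rw [map_sub, map_add, map_pow, map_pow, map_one] at h
  change mk k .X * mk k .X = 1 - mk k (.C .X) * mk k (.C .X)
  linear_combination h

theorem exists_eq (a : A1 k) : ∃ f g, a = ev k f + ev k g * qA k := by
  obtain ⟨h, rfl⟩ := mk_surjective k a
  induction h using Polynomial.induction_on with
  | C f => exact ⟨f, 0, by rw [map_zero, zero_mul, add_zero]; rfl⟩
  | add x y hx hy =>
    obtain ⟨f, g, hx⟩ := hx
    obtain ⟨f', g', hy⟩ := hy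
    refine ⟨f + f', g + g', ?_⟩
    rw [map_add, hx, hy, map_add, map_add]; ring
  | monomial n a h =>
    obtain ⟨f, g, h⟩ := h
    -- Multiplication by `q₁` swaps the two coefficients, with `q₁² = 1 - p₁²`.
    refine ⟨g * (1 - .X * .X), f, ?_⟩
    rw [pow_succ, ← mul_assoc, map_mul, h]
    change _ * qA k = _
    simp only [map_mul, map_sub, map_one]
    linear_combination ev k g * qA_mul_qA k

theorem parity_ev (f : Polynomial k) : parity k (ev k f) = ev k f := by
  change mk k (flipQ k (.C f)) = mk k (.C f)
  congr 1
  change Polynomial.aeval _ (Polynomial.C f) = _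
  rw [Polynomial.aeval_C]; rfl

theorem parity_qA : parity k (qA k) = -qA k := by
  change mk k (flipQ k .X) = -mk k .X
  rw [← map_neg]
  congr 1
  change Polynomial.aeval _ Polynomial.X = _
  rw [Polynomial.aeval_X]

/-- The homomorphism `p₁ ↦ (X + X⁻¹) / 2`, `q₁ ↦ ω (X - X⁻¹) / 2`, where `ω² = -1`. -/
def toQuad : A1 k →+* QuadraticAlgebra k[T;T⁻¹] (-1) 0 :=
  Ideal.Quotient.lift (circleIdeal k)
    (Polynomial.eval₂RingHom
      ((algebraMap k[T;T⁻¹] (QuadraticAlgebra k[T;T⁻¹] (-1) 0)).comp (evL k : Polynomial k →+* _))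
      ⟨0, lD k⟩) (by
    intro f hf
    have h : circleIdeal k ≤ RingHom.ker (Polynomial.eval₂RingHom
      ((algebraMap k[T;T⁻¹] (QuadraticAlgebra k[T;T⁻¹] (-1) 0)).comp (evL k : Polynomial k →+* _))
      ⟨0, lD k⟩) := by
      rw [circleIdeal, Ideal.span_le, Set.singleton_subset_iff]
      refine RingHom.mem_ker.2 ?_
      simp only [map_sub, map_add, map_pow, map_one, Polynomial.coe_eval₂RingHom,
        Polynomial.eval₂_C, Polynomial.eval₂_X, RingHom.comp_apply, RingHom.coe_coe, evL_X]
      have h := lD_mul_lD k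
      ext
      · simp [pow_two, h, QuadraticAlgebra.re_one]
      · simp [pow_two, QuadraticAlgebra.im_one]
    exact h hf)

theorem toQuad_ev (f : Polynomial k) : toQuad k (ev k f) = algebraMap _ _ (evL k f) :=
  Polynomial.eval₂_C _ _

theorem toQuad_qA : toQuad k (qA k) = ⟨0, lD k⟩ := Polynomial.eval₂_X _ _

/-- The additive bijection `f(p₁) + g(p₁) q₁ ↦ f(P) + g(P) D`, where `P = (X + X⁻¹) / 2` and
`D = (X - X⁻¹) / 2`. -/
def theta : A1 k →+ k[T;T⁻¹] where
  toFun a := (toQuad k a).re + (toQuad k a).im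
  map_zero' := by simp
  map_add' a b := by simp only [map_add, QuadraticAlgebra.re_add, QuadraticAlgebra.im_add]; ring

theorem theta_apply (f g : Polynomial k) :
    theta k (ev k f + ev k g * qA k) = evL k f + evL k g * lD k := by
  change (toQuad k _).re + (toQuad k _).im = _
  rw [map_add, map_mul, toQuad_ev, toQuad_ev, toQuad_qA]
  simp

/-- Existence of the normal forms on both sides and uniqueness on the Laurent side suffice. The ring
map `toQuad` already makes `θ` well defined, so uniqueness in `𝒜₁` comes out as a consequence. -/
theorem theta_bijective : Function.Bijective (theta k) := by
  constructor
  · rw [injective_iff_map_eq_zero]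
    intro a ha
    obtain ⟨f, g, rfl⟩ := exists_eq k a
    rw [theta_apply] at ha
    obtain ⟨rfl, rfl⟩ := evL_add_eq_zero k ha
    simp
  · intro x
    obtain ⟨f, g, rfl⟩ := exists_eq_evL_add k x
    exact ⟨_, theta_apply k f g⟩

theorem theta_parity (a : A1 k) : theta k (parity k a) = invert (theta k a) := by
  obtain ⟨f, g, rfl⟩ := exists_eq k a
  have h : parity k (ev k f + ev k g * qA k) = ev k f + ev k (-g) * qA k := by
    rw [map_add, map_mul, parity_ev, parity_ev, parity_qA, map_neg, neg_mul, mul_neg]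
  rw [h, theta_apply, theta_apply, map_add, map_mul, invert_evL, invert_evL, invert_lD, map_neg,
    neg_mul, mul_neg]

theorem theta_ev_mul (h : Polynomial k) (a : A1 k) :
    theta k (ev k h * a) = evL k h * theta k a := by
  obtain ⟨f, g, rfl⟩ := exists_eq k a
  rw [mul_add, ← mul_assoc, ← map_mul, ← map_mul, theta_apply, theta_apply, map_mul, map_mul]
  ring

/-- The sign discrepancy between `q₁² = 1 - p₁²` and `D² = P² - 1` is absorbed by the inversion.
Thus `θ`, though not multiplicative, still carries homogeneous ideals to ideals. -/
theorem theta_qA_mul (a : A1 k) : theta k (qA k * a) = lD k * invert (theta k a) := by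
  obtain ⟨f, g, rfl⟩ := exists_eq k a
  have h : qA k * (ev k f + ev k g * qA k) = ev k (g * (1 - .X * .X)) + ev k f * qA k := by
    simp only [map_mul, map_sub, map_one]
    linear_combination ev k g * qA_mul_qA k
  rw [h, theta_apply, theta_apply, map_add invert, map_mul invert, invert_evL, invert_evL,
    invert_lD]
  simp only [map_mul, map_sub, map_one, evL_X]
  linear_combination evL k g * lD_mul_lD k

end A1

variable {k}

/-- The even component of `a` is half the sum of `a` and its parity image, and the odd one is the
rest. -/
theorem isHomogeneous_of_parity_mem {I : Ideal (A1 k)} (h : ∀ a ∈ I, A1.parity k a ∈ I) :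
    I.IsHomogeneous (A1.gr k) := by
  have h0 : ∀ a ∈ I, (DirectSum.decompose (A1.gr k) a 0 : A1 k) ∈ I := by
    intro a ha
    have e := eq_decompose_add (A1.gr k) a
    have h0 := mem_superGr.1 (SetLike.coe_mem (DirectSum.decompose (A1.gr k) a 0))
    have h1 := mem_superGr.1 (SetLike.coe_mem (DirectSum.decompose (A1.gr k) a 1))
    have e2 := congrArg (A1.parity k) e
    rw [map_add, h0, h1, sgn_zero, sgn_one, one_smul, neg_one_smul] at e2
    have : (DirectSum.decompose (A1.gr k) a 0 : A1 k) =
        algebraMap k (A1 k) 2⁻¹ * (a + A1.parity k a) := by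
      rw [← Algebra.smul_def, e2]
      nth_rewrite 2 [e]
      module
    rw [this]
    exact I.mul_mem_left _ (add_mem ha (h a ha))
  intro i a ha
  rcases zcases i with rfl | rfl
  · exact h0 a ha
  · have e := eq_decompose_add (A1.gr k) a
    rw [← sub_eq_iff_eq_add'] at e
    rw [← e]
    exact sub_mem ha (h0 a ha)

/-- Clearing denominators gives `F ∣ G X ^ n`, and `F` is coprime to `X` because its constant term
is nonzero. -/
theorem dvd_of_toLaurent_dvd {F G : Polynomial k} (hF : F.coeff 0 ≠ 0)
    (h : toLaurent F ∣ toLaurent G) : F ∣ G := by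
  obtain ⟨y, hy⟩ := h
  obtain ⟨n, y', hy'⟩ := exists_T_pow y
  have e : G * .X ^ n = F * y' := by
    apply Polynomial.toLaurent_injective
    rw [map_mul, map_mul, hy, hy', Polynomial.toLaurent_X_pow, mul_assoc]
  have hc : IsCoprime F (.X ^ n) := by
    refine IsCoprime.pow_right (IsCoprime.symm ?_)
    rw [Polynomial.irreducible_X.coprime_iff_not_dvd, Polynomial.X_dvd_iff]
    exact hF
  exact hc.dvd_of_dvd_mul_right ⟨y', e⟩

/-! ### Reciprocal polynomials and nonzero homogeneous ideals. -/

namespace CycPoly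

variable (F : CycPoly k)

/-- Take `i = d` in the coefficient condition; the leading coefficient is 1. -/
theorem coeff_zero_mul_self : F.1.coeff 0 * F.1.coeff 0 = 1 := by
  have h := F.2.2 F.1.natDegree le_rfl
  rw [Nat.sub_self, F.2.1.coeff_natDegree] at h
  exact h.symm

theorem coeff_zero_ne_zero : F.1.coeff 0 ≠ 0 := by
  intro h
  have := coeff_zero_mul_self F
  simp [h] at this

theorem reverse_eq : F.1.reverse = .C (F.1.coeff 0) * F.1 := by
  ext i
  rw [Polynomial.coeff_reverse, Polynomial.coeff_C_mul]
  rcases le_or_gt i F.1.natDegree with h | h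
  · rw [Polynomial.revAt_le h, F.2.2 i h, ← mul_assoc, coeff_zero_mul_self, one_mul]
  · rw [Polynomial.revAt_eq_self_of_lt h, Polynomial.coeff_eq_zero_of_natDegree_lt h, mul_zero]

/-- `F(X⁻¹)` is `X ^ (-d)` times the reversed polynomial, which is `a₀ F`. So the Laurent ideal
generated by `F` is stable under inversion. -/
theorem dvd_invert : toLaurent F.1 ∣ invert (toLaurent F.1) := by
  have h := toLaurent_reverse F.1
  rw [reverse_eq, map_mul] at h
  have hT : (T F.1.natDegree * T (-F.1.natDegree) : k[T;T⁻¹]) = 1 := by rw [← T_add]; simp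
  refine ⟨toLaurent (.C (F.1.coeff 0)) * T (-F.1.natDegree), ?_⟩
  linear_combination (-invert (toLaurent F.1)) * hT - T (-F.1.natDegree) * h

theorem dvd_invert_of_dvd {x : k[T;T⁻¹]} (h : toLaurent F.1 ∣ x) : toLaurent F.1 ∣ invert x := by
  obtain ⟨y, rfl⟩ := h
  rw [map_mul]
  exact (dvd_invert F).mul_right _

/-- The ideal of `𝒜₁` attached to a polynomial. -/
def ideal : Ideal (A1 k) where
  carrier := {a | toLaurent F.1 ∣ A1.theta k a}
  add_mem' {a b} ha hb := by
    change toLaurent F.1 ∣ _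
    rw [map_add]; exact dvd_add ha hb
  zero_mem' := by
    change toLaurent F.1 ∣ A1.theta k 0
    rw [map_zero]; exact dvd_zero _
  smul_mem' c a ha := by
    change _ ∣ A1.theta k (c * a)
    obtain ⟨f, g, rfl⟩ := A1.exists_eq k c
    rw [add_mul, mul_assoc, map_add, A1.theta_ev_mul, A1.theta_ev_mul, A1.theta_qA_mul]
    exact dvd_add (Dvd.dvd.mul_left ha _)
      (Dvd.dvd.mul_left (Dvd.dvd.mul_left (dvd_invert_of_dvd F ha) _) _)

theorem mem_ideal {a : A1 k} : a ∈ F.ideal ↔ toLaurent F.1 ∣ A1.theta k a := Iff.rfl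

/-- The homogeneous ideal of `𝒜₁` attached to a polynomial. -/
def toHomogIdeal : HomogIdeal k := ⟨F.ideal, by
  refine ⟨fun h => ?_, isHomogeneous_of_parity_mem fun a ha => ?_⟩
  -- The preimage of `F` itself under `θ` is a nonzero element of the ideal.
  · obtain ⟨a, ha⟩ := (A1.theta_bijective k).2 (toLaurent F.1)
    have h1 : a ∈ F.ideal := by rw [mem_ideal, ha]
    rw [h, Submodule.mem_bot] at h1
    rw [h1, map_zero] at ha
    exact F.2.1.ne_zero (Polynomial.toLaurent_eq_zero.1 ha.symm)
  · rw [mem_ideal, A1.theta_parity]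
    exact dvd_invert_of_dvd F ha⟩

theorem mem_toHomogIdeal {a : A1 k} : a ∈ F.toHomogIdeal.1 ↔ toLaurent F.1 ∣ A1.theta k a := Iff.rfl

/-- Testing the ideals on the `θ`-preimages of `F` and `G` gives divisibility both ways among
Laurent polynomials, hence among polynomials since the constant terms are nonzero; monic associates
are equal. -/
theorem toHomogIdeal_injective : Function.Injective (toHomogIdeal (k := k)) := by
  have key : ∀ F G : CycPoly k, F.toHomogIdeal = G.toHomogIdeal → F.1 ∣ G.1 := by
    intro F G h
    obtain ⟨a, ha⟩ := (A1.theta_bijective k).2 (toLaurent G.1)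
    have h1 : a ∈ G.toHomogIdeal.1 := by rw [mem_toHomogIdeal, ha]
    rw [← h, mem_toHomogIdeal, ha] at h1
    exact dvd_of_toLaurent_dvd F.coeff_zero_ne_zero h1
  intro F G h
  exact Subtype.ext (Polynomial.eq_of_monic_of_associated F.2.1 G.2.1
    (associated_of_dvd_dvd (key F G h) (key G F h.symm)))

end CycPoly

/-- Contract `J` to `k[X]`, take a generator there, and remove its power of `X` and its leading
coefficient, both of which are units in the Laurent ring. -/
theorem exists_generator {J : Ideal k[T;T⁻¹]} (hJ : J ≠ ⊥) :
    ∃ F : Polynomial k, F.Monic ∧ F.coeff 0 ≠ 0 ∧ ∀ x, x ∈ J ↔ toLaurent F ∣ x := by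
  obtain ⟨f, hf⟩ := (IsPrincipalIdealRing.principal (J.comap (toLaurent (R := k)))).principal
  have hfJ : ∀ y, toLaurent y ∈ J ↔ f ∣ y := fun y => by
    rw [← Ideal.mem_span_singleton]
    change y ∈ J.comap toLaurent ↔ _
    rw [hf]
  have hdvd : ∀ x, x ∈ J ↔ toLaurent f ∣ x := by
    intro x
    constructor
    · intro hx
      obtain ⟨n, y, hy⟩ := exists_T_pow x
      have hyJ : toLaurent y ∈ J := by rw [hy]; exact J.mul_mem_right _ hx
      rw [← (isUnit_T (R := k) (n : ℤ)).dvd_mul_right, ← hy]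
      exact map_dvd toLaurent ((hfJ y).1 hyJ)
    · intro hx
      exact J.mem_of_dvd hx ((hfJ f).2 dvd_rfl)
  have hf0 : f ≠ 0 := by
    rintro rfl
    refine hJ (le_bot_iff.1 fun x hx => ?_)
    rw [hdvd, map_zero, zero_dvd_iff] at hx
    exact hx
  obtain ⟨f', hf', hnd⟩ := Polynomial.exists_eq_pow_rootMultiplicity_mul_and_not_dvd f hf0 0
  rw [map_zero, sub_zero] at hf' hnd
  have hc : f'.coeff 0 ≠ 0 := fun h => hnd (Polynomial.X_dvd_iff.2 h)
  have hf'0 : f' ≠ 0 := by rintro rfl; simp at hc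
  have hl : f'.leadingCoeff⁻¹ ≠ 0 := inv_ne_zero (Polynomial.leadingCoeff_ne_zero.2 hf'0)
  have hu : IsUnit (toLaurent (Polynomial.C f'.leadingCoeff⁻¹)) :=
    (Polynomial.isUnit_C.2 hl.isUnit).map (toLaurent (R := k))
  have hX : IsUnit (toLaurent ((.X : Polynomial k) ^ f.rootMultiplicity 0)) := by
    rw [Polynomial.toLaurent_X_pow]; exact isUnit_T _
  have hm := Polynomial.monic_mul_leadingCoeff_inv hf'0
  refine ⟨f' * Polynomial.C f'.leadingCoeff⁻¹, hm, ?_, fun x => ?_⟩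
  · rw [Polynomial.coeff_mul_C]
    exact mul_ne_zero hc hl
  · have e : toLaurent f = toLaurent (.X ^ f.rootMultiplicity 0) * toLaurent f' := by
      rw [← map_mul, ← hf']
    rw [map_mul, hu.mul_right_dvd, hdvd, e, hX.mul_left_dvd]

/-- As `F(0) ≠ 0`, divisibility descends to `F ∣ F.reverse`, and the reverse has the same degree. So
the quotient is a constant `u`, and the constant coefficient of `F` shows that `u = a₀`. -/
theorem reciprocal_of_dvd_invert {F : Polynomial k} (hF : F.Monic) (h0 : F.coeff 0 ≠ 0)
    (h : toLaurent F ∣ invert (toLaurent F)) :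
    ∀ i ≤ F.natDegree, F.coeff i = F.coeff 0 * F.coeff (F.natDegree - i) := by
  have h1 : F ∣ F.reverse := by
    refine dvd_of_toLaurent_dvd h0 ?_
    rw [toLaurent_reverse]
    exact h.mul_right _
  obtain ⟨g, hg⟩ := h1
  have ht : F.natTrailingDegree = 0 := Polynomial.natTrailingDegree_eq_zero.2 (Or.inr h0)
  have hd : F.reverse.natDegree = F.natDegree := by
    rw [Polynomial.reverse_natDegree, ht, Nat.sub_zero]
  have hr0 : F.reverse ≠ 0 := by rw [Ne, Polynomial.reverse_eq_zero]; exact hF.ne_zero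
  have hg0 : g ≠ 0 := by rintro rfl; rw [mul_zero] at hg; exact hr0 hg
  have hgd : g.natDegree = 0 := by
    rw [hg, hF.natDegree_mul' hg0] at hd
    omega
  obtain ⟨u, rfl⟩ := Polynomial.natDegree_eq_zero.1 hgd
  have hcoef : ∀ i ≤ F.natDegree, F.coeff (F.natDegree - i) = F.coeff i * u := by
    intro i hi
    have := congrArg (fun f => f.coeff i) hg
    simp only [Polynomial.coeff_reverse, Polynomial.revAt_le hi, Polynomial.coeff_mul_C] at this
    exact this
  have hu := hcoef _ le_rfl
  rw [Nat.sub_self, hF.coeff_natDegree, one_mul] at hu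
  intro i hi
  have := hcoef (F.natDegree - i) (Nat.sub_le _ _)
  rw [Nat.sub_sub_self hi] at this
  rw [this, hu, mul_comm]

theorem CycPoly.toHomogIdeal_surjective : Function.Surjective (toHomogIdeal (k := k)) := by
  intro I
  let J : Ideal k[T;T⁻¹] :=
    { carrier := A1.theta k '' I.1
      add_mem' := by
        rintro _ _ ⟨a, ha, rfl⟩ ⟨b, hb, rfl⟩
        exact ⟨a + b, add_mem ha hb, map_add _ _ _⟩
      zero_mem' := ⟨0, zero_mem _, map_zero _⟩
      smul_mem' := by
        rintro y _ ⟨a, ha, rfl⟩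
        obtain ⟨f, g, rfl⟩ := exists_eq_evL_add k y
        -- Multiplication by `D` on the Laurent side is `a ↦ q₁ · parity(a)` on `𝒜₁`: the parity
        -- undoes the inversion in `theta_qA_mul`. This is where homogeneity of `I` enters.
        refine ⟨A1.ev k f * a + A1.ev k g * (A1.qA k * A1.parity k a),
          add_mem (I.1.mul_mem_left _ ha)
            (I.1.mul_mem_left _ (I.1.mul_mem_left _ (I.parity_mem ha))), ?_⟩
        rw [map_add, A1.theta_ev_mul, A1.theta_ev_mul, A1.theta_qA_mul, ← A1.theta_parity,
          A1.parity_parity, smul_eq_mul]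
        ring }
  have hJ : ∀ a, A1.theta k a ∈ J ↔ a ∈ I.1 := fun a =>
    ⟨fun ⟨b, hb, e⟩ => (A1.theta_bijective k).1 e ▸ hb, fun h => ⟨a, h, rfl⟩⟩
  have hJ0 : J ≠ ⊥ := by
    intro h
    refine I.2.1 (le_bot_iff.1 fun a ha => ?_)
    have := (hJ a).2 ha
    rw [h, Submodule.mem_bot] at this
    exact (A1.theta_bijective k).1 (this.trans (map_zero _).symm)
  obtain ⟨F, hF, h0, hmem⟩ := exists_generator hJ0
  have hinv : toLaurent F ∣ invert (toLaurent F) := by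
    obtain ⟨a, ha⟩ := (A1.theta_bijective k).2 (toLaurent F)
    rw [← hmem, ← ha, ← A1.theta_parity, hJ]
    refine I.parity_mem ((hJ a).1 ?_)
    rw [ha, hmem]
  let F' : CycPoly k := ⟨F, hF, reciprocal_of_dvd_invert hF h0 hinv⟩
  exact ⟨F', Subtype.ext (Ideal.ext fun a => (mem_toHomogIdeal F').trans
    ((hmem _).symm.trans (hJ a)))⟩

/-- The bijection between the polynomials and the homogeneous ideals. -/
def cycEquiv (k : Type*) [Field k] [CharZero k] : CycPoly k ≃ HomogIdeal k :=
  Equiv.ofBijective _ ⟨CycPoly.toHomogIdeal_injective, CycPoly.toHomogIdeal_surjective⟩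

end Laurent

/-! ### The ideals generated by `F(X₁)` and by `Ψ(e(F))` coincide. -/

section Generators
open LaurentPolynomial
open Polynomial (toLaurent)

variable {k : Type*} [Field k] [CharZero k] [Algebra k Kq] (m : ℕ)

/-- `X₁` as a unit. -/
def unitX : (AffHC m)ˣ := ⟨AffHC.X 0, AffHC.Xi 0, AffHC.X_Xi 0, AffHC.Xi_X 0⟩

/-- Substitution of `X₁` into Laurent polynomials. -/
def evX : k[T;T⁻¹] →+* AffHC m :=
  AddMonoidAlgebra.liftNCRingHom ((algebraMap Kq (AffHC m)).comp (algebraMap k Kq))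
    ((Units.coeHom (AffHC m)).comp (zpowersHom _ (unitX m)))
    fun x _ => Algebra.commute_algebraMap_left (algebraMap k Kq x) _

theorem evX_single (n : ℤ) (a : k) : evX m (.single n a : k[T;T⁻¹]) =
    algebraMap Kq (AffHC m) (algebraMap k Kq a) * ((unitX m ^ n : (AffHC m)ˣ) : AffHC m) :=
  AddMonoidAlgebra.liftNCRingHom_single _ _ _ _ _

theorem evX_C (a : k) : evX m (C a) = algebraMap Kq (AffHC m) (algebraMap k Kq a) := by
  rw [← single_eq_C, evX_single, zpow_zero, Units.val_one, mul_one]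

theorem evX_T_one : evX m (T 1 : k[T;T⁻¹]) = AffHC.X 0 := by
  rw [T, evX_single, map_one, map_one, one_mul, zpow_one]; rfl

theorem evX_T_neg_one : evX m (T (-1) : k[T;T⁻¹]) = AffHC.Xi 0 := by
  rw [T, evX_single, map_one, map_one, one_mul, zpow_neg_one]; rfl

theorem evX_lP : evX m (lP k) = AffHC.p 0 := by
  rw [lP, map_mul, map_add, evX_C, evX_T_one, evX_T_neg_one, map_inv₀, map_ofNat, AffHC.p, pOfX,
    Algebra.smul_def]

theorem evX_lD_mul_c : evX m (lD k) * AffHC.c 0 = AffHC.q 0 := by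
  rw [lD, map_mul, map_sub, evX_C, evX_T_one, evX_T_neg_one, map_inv₀, map_ofNat, AffHC.q, qOfX,
    Algebra.smul_def, mul_assoc]

theorem evX_toLaurent (F : Polynomial k) : evX m (toLaurent F) =
    Polynomial.aeval (AffHC.X (0 : Fin (m + 1))) (F.map (algebraMap k Kq)) := by
  have h : (evX m).comp (toLaurent (R := k)) =
      (Polynomial.aeval (R := Kq) (AffHC.X (0 : Fin (m + 1)))).toRingHom.comp
        (Polynomial.mapRingHom (algebraMap k Kq)) := by
    refine Polynomial.ringHom_ext (fun a => ?_) ?_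
    · simp [evX_C]
    · simp [evX_T_one]
  exact DFunLike.congr_fun h F

theorem psiS_toSpin_ev (f : Polynomial k) :
    psiS m (A1.toSpin m (A1.ev k f)) = evX m (evL k f) := by
  have h : ((psiS m : AffSpin m →+* AffHC m).comp (A1.toSpin m)).comp
      (A1.ev k : Polynomial k →+* A1 k) =
      (evX m).comp (evL k : Polynomial k →+* k[T;T⁻¹]) := by
    refine Polynomial.ringHom_ext (fun a => ?_) ?_
    · change psiS m (evalPQ m (.C (.C a))) = evX m (Polynomial.aeval _ (Polynomial.C a))
      rw [Polynomial.aeval_C]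
      refine Eq.trans ?_ (evX_C m a).symm
      simp [evalPQ, Polynomial.eval₂RingHom', evalP]
    · change psiS m (evalPQ m (.C .X)) = evX m (evL k .X)
      rw [evL_X, evX_lP, ← psiS_p]
      simp [evalPQ, Polynomial.eval₂RingHom', evalP]
  exact DFunLike.congr_fun h f

theorem psiS_toSpin_qA : psiS m (A1.toSpin m (A1.qA k)) = evX m (lD k) * AffHC.c 0 := by
  rw [evX_lD_mul_c, ← psiS_q]
  congr 1
  exact Polynomial.eval₂_X _ _

/-- `F` divides `f(P) + g(P) D` and, by inversion, `f(P) - g(P) D`, hence each summand. The image of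
`a` is the value of `f(P)` at `X₁` plus that of `g(P) D` times `c₁`. -/
theorem psiS_toSpin_mem_hcIdeal (F : CycPoly k) {a : A1 k} (ha : a ∈ F.toHomogIdeal.1) :
    psiS m (A1.toSpin m a) ∈ hcIdeal m F := by
  have hmem : ∀ x, toLaurent F.1 ∣ x → evX m x ∈ hcIdeal m F := by
    rintro _ ⟨y, rfl⟩
    rw [map_mul, evX_toLaurent]
    exact TwoSidedIdeal.mul_mem_right _ _ _ (TwoSidedIdeal.subset_span rfl)
  obtain ⟨f, g, rfl⟩ := A1.exists_eq k a
  have h1 := (CycPoly.mem_toHomogIdeal F).1 ha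
  have h2 := CycPoly.dvd_invert_of_dvd F h1
  rw [A1.theta_apply] at h1
  rw [A1.theta_apply, map_add, map_mul, invert_evL, invert_evL, invert_lD] at h2
  have e1 : evL k f = C 2⁻¹ * ((evL k f + evL k g * lD k) + (evL k f + evL k g * -lD k)) := by
    linear_combination (-evL k f) * two_mul_C_half k
  have e2 : evL k g * lD k =
      C 2⁻¹ * ((evL k f + evL k g * lD k) - (evL k f + evL k g * -lD k)) := by
    linear_combination (-evL k g * lD k) * two_mul_C_half k
  have d1 : toLaurent F.1 ∣ evL k f := by
    rw [e1]; exact (dvd_add h1 h2).mul_left _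
  have d2 : toLaurent F.1 ∣ evL k g * lD k := by
    rw [e2]; exact (dvd_sub h1 h2).mul_left _
  rw [map_add, map_add, map_mul, map_mul, psiS_toSpin_ev, psiS_toSpin_ev, psiS_toSpin_qA,
    ← mul_assoc, ← map_mul]
  exact TwoSidedIdeal.add_mem _ (hmem _ d1) (TwoSidedIdeal.mul_mem_right _ _ _ (hmem _ d2))

/-- Write `F = θ(a)` with `a = f(p₁) + g(p₁) q₁`. Homogeneity puts both parts of `a` in the ideal,
so the values at `X₁` of `f(P)` and, after a Clifford generator is removed, of `g(P) D` lie in `J`;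
they add up to `F(X₁)`. -/
theorem hcIdeal_le (F : CycPoly k) {J : TwoSidedIdeal (AffHC m)}
    (hJ : ∀ a ∈ F.toHomogIdeal.1, psiS m (A1.toSpin m a) ∈ J) : hcIdeal m F ≤ J := by
  refine TwoSidedIdeal.span_le.2 (Set.singleton_subset_iff.2 ?_)
  rw [← evX_toLaurent]
  obtain ⟨a, ha⟩ := (A1.theta_bijective k).2 (toLaurent F.1)
  have haI : a ∈ F.toHomogIdeal.1 := by rw [CycPoly.mem_toHomogIdeal, ha]
  have hpI := F.toHomogIdeal.parity_mem haI
  obtain ⟨f, g, rfl⟩ := A1.exists_eq k a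
  rw [map_add, map_mul, A1.parity_ev, A1.parity_ev, A1.parity_qA] at hpI
  have half : algebraMap k (A1 k) 2⁻¹ * 2 = 1 := by
    rw [← map_ofNat (algebraMap k (A1 k)) 2, ← map_mul, inv_mul_cancel₀ two_ne_zero, map_one]
  have h1 : A1.ev k f ∈ F.toHomogIdeal.1 := by
    convert F.toHomogIdeal.1.mul_mem_left (algebraMap k (A1 k) 2⁻¹) (add_mem haI hpI) using 1
    linear_combination (-A1.ev k f) * half
  have h2 : A1.ev k g * A1.qA k ∈ F.toHomogIdeal.1 := by
    simpa using sub_mem haI h1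
  have m1 := hJ _ h1
  have m2 := hJ _ h2
  rw [psiS_toSpin_ev] at m1
  rw [map_mul, map_mul, psiS_toSpin_ev, psiS_toSpin_qA, ← mul_assoc, ← map_mul] at m2
  -- The factor `c₁` coming from `Ψ(q₁)` is cancelled by `c₁² = 1`.
  have m3 := TwoSidedIdeal.mul_mem_right _ _ (AffHC.c 0) m2
  rw [mul_assoc, AffHC.c_sq, mul_one] at m3
  rw [← ha, A1.theta_apply, map_add]
  exact TwoSidedIdeal.add_mem _ m1 m3

end Generators

/-! ### The isomorphisms of cyclotomic quotients -/

section Quotients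

variable {k : Type*} [Field k] [CharZero k] [Algebra k Kq] (m : ℕ)

/-- A homomorphism killing a two-sided ideal descends to the quotient. -/
def quotLift {A B : Type*} [Ring A] [Algebra Kq A] [Ring B] [Algebra Kq B] (I : TwoSidedIdeal A)
    (f : A →ₐ[Kq] B) (hf : I ≤ TwoSidedIdeal.ker f) : I.ringCon.Quotient →ₐ[Kq] B :=
  I.ringCon.liftₐ f (TwoSidedIdeal.ringCon_le_iff.1 hf)

theorem mkₐ_eq_zero {A : Type*} [Ring A] [Algebra Kq A] (I : TwoSidedIdeal A) {a : A} :
    I.ringCon.mkₐ (α := Kq) a = 0 ↔ a ∈ I := by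
  rw [← map_zero (I.ringCon.mkₐ (α := Kq)), TwoSidedIdeal.mem_iff]
  exact RingCon.eq I.ringCon

variable (I : HomogIdeal k)

/-- `c ∈ 𝒞ₙ` as an element of `𝒞ₙ ⊗` (cyclotomic spin Hecke algebra). -/
def inCycC : Cliff m →ₐ[Kq] CliffCycSpin m I :=
  GradedTensorProduct.includeLeft (cliffGr m) (CycSpin.gr m I)

/-- An element of the cyclotomic spin Hecke algebra as an element of the tensor product. -/
def inCycS : CycSpin m I →ₐ[Kq] CliffCycSpin m I :=
  GradedTensorProduct.includeRight (cliffGr m) (CycSpin.gr m I)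

theorem inCyc_anticomm ⦃i j : ZMod 2⦄ (a : cliffGr m i) (b : CycSpin.gr m I j) :
    inCycC m I a * inCycS m I b = ((-1 : ℤˣ) ^ (j * i)) • (inCycS m I b * inCycC m I a) :=
  ((GradedTensorProduct.liftEquiv (cliffGr m) (CycSpin.gr m I)).symm
    (AlgHom.id Kq (CliffCycSpin m I))).2 a b

theorem mk_mem_gr {j : ZMod 2} {b : AffSpin m} (hb : b ∈ AffSpin.gr m j) :
    CycSpin.mk m I b ∈ CycSpin.gr m I j := ⟨b, hb, rfl⟩

theorem cliffMk_anticomm ⦃i j : ZMod 2⦄ (a : cliffGr m i) (b : AffSpin.gr m j) :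
    inCycC m I a * (inCycS m I).comp (CycSpin.mk m I) b =
      ((-1 : ℤˣ) ^ (j * i)) • ((inCycS m I).comp (CycSpin.mk m I) b * inCycC m I a) :=
  inCyc_anticomm m I a ⟨_, mk_mem_gr m I b.2⟩

/-- The quotient map of the tensor products as a homomorphism of algebras. -/
def cliffMk : CliffSpin m →ₐ[Kq] CliffCycSpin m I :=
  GradedTensorProduct.lift (cliffGr m) (AffSpin.gr m) (inCycC m I)
    ((inCycS m I).comp (CycSpin.mk m I))
    (cliffMk_anticomm m I)

theorem cliffMk_inC (a : Cliff m) : cliffMk m I (inC a) = inCycC m I a := by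
  change cliffMk m I (a ᵍ⊗ₜ[Kq] 1) = _
  rw [cliffMk, GradedTensorProduct.lift_tmul, map_one, mul_one]

theorem cliffMk_inS (b : AffSpin m) : cliffMk m I (inS b) = inCycS m I (CycSpin.mk m I b) := by
  change cliffMk m I (1 ᵍ⊗ₜ[Kq] b) = _
  rw [cliffMk, GradedTensorProduct.lift_tmul, map_one, one_mul]; rfl

theorem cliffMk_tmul (a : Cliff m) (b : AffSpin m) :
    cliffMk m I (a ᵍ⊗ₜ[Kq] b) = a ᵍ⊗ₜ[Kq] CycSpin.mk m I b := by
  rw [cliffMk, GradedTensorProduct.lift_tmul]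
  exact GradedTensorProduct.tmul_one_mul_one_tmul (cliffGr m) (CycSpin.gr m I) _ _

/-- The quotient map of tensor products is given as a linear map; this identifies it with an algebra
homomorphism, by comparison on pure tensors. -/
theorem cliffMk_apply (y : CliffSpin m) : CliffCycSpin.mk m I y = cliffMk m I y := by
  have h : CliffCycSpin.mk m I = (cliffMk m I).toLinearMap := by
    refine GradedTensorProduct.hom_ext _ _ (TensorProduct.ext' fun a b => ?_)
    exact (cliffMk_tmul m I a b).symm
  exact DFunLike.congr_fun h y

variable (F : CycPoly k)

/-- By `hcIdeal_le` it suffices to kill `Ψ(a)` for `a` in `e(F)`, and `Φ(Ψ(a)) = 1 ⊗ a`. Keeping `I`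
variable with a proof of `e(F) = I` lets one construction serve both `I = e(F)` and `F = e⁻¹(I)`. -/
theorem hcIdeal_le_ker (h : F.toHomogIdeal = I) :
    hcIdeal m F ≤ TwoSidedIdeal.ker ((cliffMk m I).comp (phi m)) := by
  subst h
  refine hcIdeal_le m F fun a ha => (TwoSidedIdeal.mem_ker _).2 ?_
  have h : A1.toSpin m a ∈ spinIdeal m F.toHomogIdeal :=
    TwoSidedIdeal.subset_span ⟨a, ha, rfl⟩
  rw [AlgHom.comp_apply, phi_psiS, cliffMk_inS, CycSpin.mk, (mkₐ_eq_zero _).2 h, map_zero]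

theorem spinIdeal_le_ker (h : F.toHomogIdeal = I) :
    spinIdeal m I ≤ TwoSidedIdeal.ker ((CycHC.mk m F).comp (psiS m)) := by
  subst h
  refine TwoSidedIdeal.span_le.2 ?_
  rintro _ ⟨a, ha, rfl⟩
  refine (TwoSidedIdeal.mem_ker _).2 ?_
  rw [AlgHom.comp_apply, CycHC.mk, mkₐ_eq_zero]
  exact psiS_toSpin_mem_hcIdeal m F ha

variable {I F} (h : F.toHomogIdeal = I)

/-- The homomorphism induced by `Φ` on the cyclotomic Hecke-Clifford algebra. -/
def cycPhi : CycHC m F →ₐ[Kq] CliffCycSpin m I :=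
  quotLift (hcIdeal m F) ((cliffMk m I).comp (phi m)) (hcIdeal_le_ker m I F h)

theorem cycPhi_mk (x : AffHC m) : cycPhi m h (CycHC.mk m F x) = cliffMk m I (phi m x) := rfl

/-- The restriction to the cyclotomic spin Hecke algebra of the homomorphism induced by `Ψ`. -/
def cycPsiS : CycSpin m I →ₐ[Kq] CycHC m F :=
  quotLift (spinIdeal m I) ((CycHC.mk m F).comp (psiS m)) (spinIdeal_le_ker m I F h)

theorem cycPsiS_mk (b : AffSpin m) :
    cycPsiS m h (CycSpin.mk m I b) = CycHC.mk m F (psiS m b) := rfl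

/-- A homogeneous element of the quotient is the image of a homogeneous element, so this is the
image of `psi_anticomm`. -/
theorem cycPsi_anticomm ⦃i j : ZMod 2⦄ (a : cliffGr m i) (b : CycSpin.gr m I j) :
    (CycHC.mk m F).comp (psiC m) a * cycPsiS m h b =
      ((-1 : ℤˣ) ^ (j * i)) • (cycPsiS m h b * (CycHC.mk m F).comp (psiC m) a) := by
  obtain ⟨_, b, hb, rfl⟩ := b
  have e := congrArg (CycHC.mk m F) (psi_anticomm a ⟨b, hb⟩)
  rw [zpow_sgn_smul, map_smul, map_mul, map_mul] at e
  rw [zpow_sgn_smul]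
  exact e

/-- The homomorphism induced by `Ψ`. -/
def cycPsi : CliffCycSpin m I →ₐ[Kq] CycHC m F :=
  GradedTensorProduct.lift (cliffGr m) (CycSpin.gr m I) ((CycHC.mk m F).comp (psiC m))
    (cycPsiS m h) (cycPsi_anticomm m h)

theorem cycPsi_inCycC (a : Cliff m) : cycPsi m h (inCycC m I a) = CycHC.mk m F (psiC m a) := by
  change cycPsi m h (a ᵍ⊗ₜ[Kq] 1) = _
  rw [cycPsi, GradedTensorProduct.lift_tmul, map_one, mul_one]; rfl

theorem cycPsi_inCycS (b : CycSpin m I) : cycPsi m h (inCycS m I b) = cycPsiS m h b := by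
  change cycPsi m h (1 ᵍ⊗ₜ[Kq] b) = _
  rw [cycPsi, GradedTensorProduct.lift_tmul, map_one, one_mul]

theorem cycPsi_cliffMk (y : CliffSpin m) :
    cycPsi m h (cliffMk m I y) = CycHC.mk m F (psi m y) := by
  have e : (cycPsi m h).comp (cliffMk m I) = (CycHC.mk m F).comp (psi m) := by
    refine GradedTensorProduct.algHom_ext _ _ (AlgHom.ext fun a => ?_) (AlgHom.ext fun b => ?_)
    · change cycPsi m h (cliffMk m I (inC a)) = CycHC.mk m F (psi m (inC a))
      rw [cliffMk_inC, cycPsi_inCycC, psi_inC]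
    · change cycPsi m h (cliffMk m I (inS b)) = CycHC.mk m F (psi m (inS b))
      rw [cliffMk_inS, cycPsi_inCycS, psi_inS, cycPsiS_mk]
  exact DFunLike.congr_fun e y

theorem psi_phi (x : AffHC m) : psi m (phi m x) = x := DFunLike.congr_fun psi_comp_phi x
theorem phi_psi (y : CliffSpin m) : phi m (psi m y) = y := DFunLike.congr_fun phi_comp_psi y

theorem cliffMk_surjective : Function.Surjective (cliffMk m I) := by
  intro z
  induction z using TensorProduct.induction_on with
  | zero => exact ⟨0, map_zero _⟩
  | tmul a b =>
    obtain ⟨b, rfl⟩ := RingCon.mkₐ_surjective (α := Kq) (spinIdeal m I).ringCon b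
    exact ⟨a ᵍ⊗ₜ[Kq] b, cliffMk_tmul m I a b⟩
  | add x y hx hy =>
    obtain ⟨x, rfl⟩ := hx
    obtain ⟨y, rfl⟩ := hy
    exact ⟨x + y, map_add _ _ _⟩

/-- The isomorphism of cyclotomic quotients. -/
def cycEquivAlg : CycHC m F ≃ₐ[Kq] CliffCycSpin m I :=
  AlgEquiv.ofAlgHom (cycPhi m h) (cycPsi m h)
    (AlgHom.ext fun z => by
      obtain ⟨y, rfl⟩ := cliffMk_surjective m z
      rw [AlgHom.comp_apply, cycPsi_cliffMk, cycPhi_mk, phi_psi]; rfl)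
    (AlgHom.ext fun z => by
      obtain ⟨x, rfl⟩ := RingCon.mkₐ_surjective (α := Kq) (hcIdeal m F).ringCon z
      change cycPsi m h (cycPhi m h (CycHC.mk m F x)) = CycHC.mk m F x
      rw [cycPhi_mk, cycPsi_cliffMk, psi_phi])

theorem cycEquivAlg_mk (x : AffHC m) :
    cycEquivAlg m h (CycHC.mk m F x) = cliffMk m I (phi m x) := rfl

theorem cycEquivAlg_symm_mk (y : CliffSpin m) :
    (cycEquivAlg m h).symm (cliffMk m I y) = CycHC.mk m F (psi m y) := cycPsi_cliffMk m h y

theorem map_cliffMk_tensorGr (i : ZMod 2) :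
    (tensorGr (cliffGr m) (AffSpin.gr m) i).map (cliffMk m I).toLinearMap =
      tensorGr (cliffGr m) (CycSpin.gr m I) i := by
  rw [tensorGr, Submodule.map_span]
  refine congrArg (Submodule.span Kq) (Set.ext fun z => ⟨?_, ?_⟩)
  · rintro ⟨_, ⟨j, l, hjl, a, ha, b, hb, rfl⟩, rfl⟩
    exact ⟨j, l, hjl, a, ha, _, mk_mem_gr m I hb, cliffMk_tmul m I a b⟩
  · rintro ⟨j, l, hjl, a, ha, _, ⟨b, hb, rfl⟩, rfl⟩
    exact ⟨_, ⟨j, l, hjl, a, ha, b, hb, rfl⟩, cliffMk_tmul m I a b⟩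

/-- Both gradings are images of the affine ones under the quotient maps, and these maps intertwine
`Φ` with the induced isomorphism. -/
theorem isSuper_cycEquivAlg :
    IsSuper (CycHC.gr m F) (tensorGr (cliffGr m) (CycSpin.gr m I)) (cycEquivAlg m h) := by
  intro i
  rw [← map_cliffMk_tensorGr, ← isSuper_phiEquiv i, ← Submodule.map_comp]
  exact (Submodule.map_comp _ _ _).symm

theorem isSuper_symm {A B : Type*} [Ring A] [Algebra Kq A] [Ring B] [Algebra Kq B]
    {𝒜 : ZMod 2 → Submodule Kq A} {ℬ : ZMod 2 → Submodule Kq B} {f : A ≃ₐ[Kq] B}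
    (hf : IsSuper 𝒜 ℬ f) : IsSuper ℬ 𝒜 f.symm := by
  intro i
  rw [← hf i, ← Submodule.map_comp]
  convert Submodule.map_id _
  ext a
  exact f.symm_apply_apply a

/-! ### The bijection of the defining ideals -/

theorem mem_hcIdeal_iff (F : CycPoly k) (x : AffHC m) :
    x ∈ hcIdeal m F ↔ CliffCycSpin.mk m F.toHomogIdeal (phi m x) = 0 := by
  rw [cliffMk_apply, ← cycEquivAlg_mk m rfl, EmbeddingLike.map_eq_zero_iff, CycHC.mk, mkₐ_eq_zero]

/-- Over a field, `b ↦ 1 ⊗ b` is injective as soon as the scalars embed in the other factor; the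
Clifford algebra contains its scalars, 2 being invertible. -/
theorem inCycS_injective (I : HomogIdeal k) : Function.Injective (inCycS m I) := by
  let _ : Invertible (2 : Kq) := invertibleOfNonzero two_ne_zero
  have h := Algebra.TensorProduct.includeRight_injective (R := Kq) (A := Cliff m)
    (B := CycSpin m I) (FaithfulSMul.algebraMap_injective Kq (Cliff m))
  exact h

theorem mem_spinIdeal_iff (F : CycPoly k) (b : AffSpin m) :
    b ∈ spinIdeal m F.toHomogIdeal ↔ psiS m b ∈ hcIdeal m F := by
  rw [mem_hcIdeal_iff, cliffMk_apply, phi_psiS, cliffMk_inS,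
    map_eq_zero_iff _ (inCycS_injective m _), CycSpin.mk, mkₐ_eq_zero]

/-- The two targets are different types with different gradings. Expressed through the underlying
ungraded tensor product, the condition depends only on the two-sided ideal, and the equality can be
rewritten. -/
theorem cliffCycSpin_mk_eq_zero_congr {I I' : HomogIdeal k} (h : spinIdeal m I = spinIdeal m I')
    (y : CliffSpin m) : CliffCycSpin.mk m I y = 0 ↔ CliffCycSpin.mk m I' y = 0 := by
  have key : ∀ I : HomogIdeal k, CliffCycSpin.mk m I y = 0 ↔
      TensorProduct.map LinearMap.id ((spinIdeal m I).ringCon.mkₐ (α := Kq)).toLinearMap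
        ((GradedTensorProduct.of Kq (cliffGr m) (AffSpin.gr m)).symm y) = 0 := fun I => Iff.rfl
  rw [key, key, h]

/-- Gives well-definedness and injectivity of the map on defining ideals at once, without deciding
whether different `F` can give the same ideal. -/
theorem hcIdeal_eq_iff (F G : CycPoly k) : hcIdeal m F = hcIdeal m G ↔
    spinIdeal m F.toHomogIdeal = spinIdeal m G.toHomogIdeal := by
  constructor
  · intro h
    refine TwoSidedIdeal.ext fun b => ?_
    rw [mem_spinIdeal_iff, mem_spinIdeal_iff, h]
  · intro h
    refine TwoSidedIdeal.ext fun x => ?_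
    rw [mem_hcIdeal_iff, mem_hcIdeal_iff, cliffCycSpin_mk_eq_zero_congr m h]

/-- Choose a preimage for each element of the range of `f`; the forward implication makes the value
independent of the choice, the backward one makes the map injective. -/
theorem exists_equiv_range {α β γ δ : Type*} (e : α ≃ β) (f : α → γ) (g : β → δ)
    (h : ∀ a b, f a = f b ↔ g (e a) = g (e b)) :
    ∃ E : Set.range f ≃ Set.range g, ∀ a, (E ⟨f a, a, rfl⟩ : δ) = g (e a) := by
  choose s hs using fun x : Set.range f => x.2
  have hE : ∀ a, g (e (s ⟨f a, a, rfl⟩)) = g (e a) := fun a => (h _ _).1 (hs ⟨f a, a, rfl⟩)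
  refine ⟨Equiv.ofBijective (fun x => ⟨g (e (s x)), _, rfl⟩) ⟨?_, ?_⟩, hE⟩
  · rintro x y hxy
    have := (h _ _).2 (Subtype.ext_iff.1 hxy)
    rw [hs, hs] at this
    exact Subtype.ext this
  · rintro ⟨_, b, rfl⟩
    refine ⟨⟨f (e.symm b), _, rfl⟩, Subtype.ext ?_⟩
    change g (e (s _)) = g b
    rw [hE, e.apply_symm_apply]

end Quotients

end SpinHecke
end

/-! ### The main theorem. -/

open SpinHecke
theorem mainTheorem7 (k : Type*) [Field k] [CharZero k] [Algebra k Kq] (m : ℕ) :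
    ∃ Φ : AffHC m ≃ₐ[Kq] CliffSpin m,
      IsPhi Φ ∧ IsPsi Φ.symm ∧ IsSuper (AffHC.gr m) (tensorGr (cliffGr m) (AffSpin.gr m)) Φ ∧
      ∃ e : CycPoly k ≃ HomogIdeal k,
        -- the bijection between the two sets of quotient algebras
        (∃ E : Set.range (hcIdeal (k := k) m) ≃ Set.range (spinIdeal (k := k) m),
          ∀ F : CycPoly k, (E ⟨hcIdeal m F, F, rfl⟩ : TwoSidedIdeal (AffSpin m)) =
            spinIdeal m (e F)) ∧
        -- the isomorphisms induced by `Φ`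
        (∀ F : CycPoly k, ∃ φ : CycHC m F ≃ₐ[Kq] CliffCycSpin m (e F),
          (∀ x, φ (CycHC.mk m F x) = CliffCycSpin.mk m (e F) (Φ x)) ∧
          IsSuper (CycHC.gr m F) (tensorGr (cliffGr m) (CycSpin.gr m (e F))) φ) ∧
        -- the isomorphisms induced by `Ψ`
        (∀ I : HomogIdeal k, ∃ ψ : CliffCycSpin m I ≃ₐ[Kq] CycHC m (e.symm I),
          (∀ y, ψ (CliffCycSpin.mk m I y) = CycHC.mk m (e.symm I) (Φ.symm y)) ∧
          IsSuper (tensorGr (cliffGr m) (CycSpin.gr m I)) (CycHC.gr m (e.symm I)) ψ) := by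
  refine ⟨phiEquiv m, isPhi, isPsi, isSuper_phiEquiv, cycEquiv k,
    exists_equiv_range (cycEquiv k) _ _ (hcIdeal_eq_iff m), fun F => ?_, fun I => ?_⟩
  · have h : F.toHomogIdeal = cycEquiv k F := rfl
    refine ⟨cycEquivAlg m h, fun x => ?_, isSuper_cycEquivAlg m h⟩
    rw [cycEquivAlg_mk, cliffMk_apply]; rfl
  · have h : ((cycEquiv k).symm I).toHomogIdeal = I := (cycEquiv k).apply_symm_apply I
    refine ⟨(cycEquivAlg m h).symm, fun y => ?_, isSuper_symm (isSuper_cycEquivAlg m h)⟩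
    rw [cliffMk_apply, cycEquivAlg_symm_mk]; rfl
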